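/- **Setting.** Let $M$ be a smooth manifold and let $E\to M$ be a smooth *quaternionic vector bundle*: a real vector bundle with typical fibre $\mathbb{H}^k$ and structural group $\mathrm{Sp}(1)\cdot\mathrm{GL}(k,\mathbb{H})$, acting on $\mathbb{H}^k$ by $q\mapsto aqA^{-1}$. The *admissible linear complex structures* on a fibre of $E$ are the endomorphisms which, in an admissible frame, are given by left multiplication by an imaginary quaternion of length $1$; they form a bundle $\pi:Z\to M$ with fibre $S^2$, where each fibre $Z_x$ carries the complex structure given by $A\mapsto JA$ on $T_JZ_x\subseteq\mathrm{End}(E_x)$. For $J\in Z$ let $E^J=\ker(J+\mathrm{i})\subseteq E^{\mathbb{C}}_{\pi(J)}$. Let $\rho:E\to TM$ be a morphism of vector bundles such that $(E,\rho)$ is an *almost co-CR quaternionic structure*: $\rho$ is surjective and its kernel contains no nonzero subspace preserved by some $J\in Z$. Let $\nabla$ be a smooth connection on $E$ which is *compatible* (with the structural group of $E$), and let $R$ be its curvature form. It is *torsion free* (with respect to $\rho$) if $\rho(\nabla_{\rho\circ s_1}s_2-\nabla_{\rho\circ s_2}s_1)=[\rho\circ s_1,\rho\circ s_2]$ for all local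 sections $s_1,s_2$ of $E$. It *satisfies the first Bianchi identity with respect to $Z$* if it is torsion free and, extending $R$ and $\rho$ complex multilinearly, $$R(\rho(e_1),\rho(e_2))e_3+R(\rho(e_2),\rho(e_3))e_1+R(\rho(e_3),\rho(e_1))e_2=0$$ for all $J\in Z$ and $e_1,e_2,e_3\in E^J$. Let $\mathcal{C}$ be the complex distribution on $Z$ given by $\mathcal{C}=(\ker d\pi)^{0,1}\oplus\mathcal{B}$, where $\mathcal{B}_J$ is the horizontal lift of $\rho(E^J)$ at $J\in Z$, with respect to the connection induced by $\nabla$ on $Z$. One says that $(E,\rho,\nabla)$ is *integrable* if $\mathcal{C}$ is integrable, that is, the Lie bracket of any two local sections of $\mathcal{C}$ is a section of $\mathcal{C}$. **Corollary 2.3.** Let $(M,E,\rho)$ be an almost co-CR quaternionic manifold with $\operatorname{rank}E>4$ (real rank, so $k\geq2$). If $\nabla$ is a compatible connection on $E$ which satisfies the first Bianchi identity with respect to $Z$, then $(E,\rho,\nabla)$ is integrable. -/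

import Mathlib

open Bundle Set Manifold ContDiff Quaternion

noncomputable section

namespace CoCR

/-! ### Complexification

A vector `u + i v` of the complexification of a real vector space is written as the pair `(u, v)`. -/

/-- The kernel of `J + i` on the complexification of a real vector space, for a real linear
operator `J`: the pairs `(u, v)` with `(J + i) (u + i v) = (J u - v) + i (J v + u) = 0`. -/
def kerAddI {W : Type*} [AddCommGroup W] [Module ℝ W] (J : W →ₗ[ℝ] W) : Set (W × W) :=
  {w | J w.1 - w.2 = 0 ∧ J w.2 + w.1 = 0}

/-- The complex bilinear extension of a real bilinear operation `b`:
`b (u + i v, u' + i v') = (b (u, u') - b (v, v')) + i (b (u, v') + b (v, u'))`. -/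
def complexify₂ {A B C : Type*} [Add C] [Sub C] (b : A → B → C) (w : A × A) (w' : B × B) : C × C :=
  (b w.1 w'.1 - b w.2 w'.2, b w.1 w'.2 + b w.2 w'.1)

/-! ### Quaternions and the two-sphere of imaginary units -/

/-- The typical fibre `ℍᵏ`. -/
abbrev QSpace (k : ℕ) : Type := Fin k → ℍ[ℝ]

/-- The two-sphere. -/
abbrev S2 : Type := Metric.sphere (0 : EuclideanSpace ℝ (Fin 3)) 1

/-- The identification of `ℝ³` with the space of imaginary quaternions, which maps `S2` onto the
imaginary quaternions of length `1`. -/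
def imQ (v : EuclideanSpace ℝ (Fin 3)) : ℍ[ℝ] := ⟨0, v 0, v 1, v 2⟩

/-- Left multiplication by a quaternion on `ℍᵏ`, `q ↦ (a q₁, …, a q_k)`. -/
def leftMul (k : ℕ) (a : ℍ[ℝ]) : QSpace k →ₗ[ℝ] QSpace k where
  toFun q := fun i => a * q i
  map_add' q q' := by ext1 i; simp [mul_add]
  map_smul' c q := by ext1 i; simp

section Bundles

variable {EM : Type*} [NormedAddCommGroup EM] [NormedSpace ℝ EM]
  {M : Type*} [TopologicalSpace M] [ChartedSpace EM M]
  [IsManifold 𝓘(ℝ, EM) 1 M] {k : ℕ}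
  {V : M → Type*} [TopologicalSpace (TotalSpace (QSpace k) V)]
  [∀ x, AddCommGroup (V x)] [∀ x, Module ℝ (V x)] [∀ x, TopologicalSpace (V x)]
  [FiberBundle (QSpace k) V] [VectorBundle ℝ (QSpace k) V]

/-! ### Quaternionic vector bundles -/

variable (k V) in
/-- The vector bundle `V`, with typical fibre `ℍᵏ` and with its given atlas of trivializations, is
a quaternionic vector bundle: its structural group is `Sp(1)·GL(k,ℍ)`, that is, the transition
functions are of the form `q ↦ a q A⁻¹`, with `a` a unit quaternion and `A ∈ GL(k,ℍ)`
(the elements of `ℍᵏ` are thought of as row vectors). -/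
def IsQuaternionicVectorBundle : Prop :=
  ∀ (e e' : Trivialization (QSpace k) (π (QSpace k) V))
    [MemTrivializationAtlas e] [MemTrivializationAtlas e'],
    ∀ x ∈ e.baseSet ∩ e'.baseSet, ∃ (a : ℍ[ℝ]) (A : (Matrix (Fin k) (Fin k) ℍ[ℝ])ˣ),
      ‖a‖ = 1 ∧ ∀ q : QSpace k,
        e.coordChangeL ℝ e' x q = Matrix.vecMul (leftMul k a q) (A⁻¹).val

/-- The endomorphism of the fibre of `V` over `x` which corresponds to left multiplication by the
imaginary quaternion `a ∈ S2` under the trivialization `e`. For `e` in the atlas of a quaternionic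
vector bundle, `(x, a) ↦ (x, trivJ e x a)` is the trivialization, over the base set of `e`, of the
bundle of admissible linear complex structures. -/
def trivJ (e : Trivialization (QSpace k) (π (QSpace k) V)) [MemTrivializationAtlas e]
    (x : M) (a : S2) : V x →ₗ[ℝ] V x :=
  e.symmₗ ℝ x ∘ₗ leftMul k (imQ a) ∘ₗ e.linearMapAt ℝ x

variable (k V) in
/-- The fibre over `x` of the bundle `Z` of admissible linear complex structures of `V`. -/
def admissible (x : M) : Set (V x →ₗ[ℝ] V x) :=
  {J | ∃ (e : Trivialization (QSpace k) (π (QSpace k) V)) (_ : MemTrivializationAtlas e),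
    x ∈ e.baseSet ∧ ∃ a : S2, J = trivJ e x a}

/-! ### Almost co-CR quaternionic structures -/

variable (k) in
/-- `(V, ρ)` is an almost co-CR quaternionic structure on `M`: `V` is a quaternionic vector bundle
and `ρ : V → TM` is a surjective (smooth) morphism of vector bundles whose kernel contains no
nonzero subspace preserved by some admissible linear complex structure. -/
structure IsAlmostCoCRQuaternionic (ρ : ∀ x : M, V x →ₗ[ℝ] TangentSpace 𝓘(ℝ, EM) x) : Prop where
  quaternionic : IsQuaternionicVectorBundle k V
  smooth : ContMDiff (𝓘(ℝ, EM).prod 𝓘(ℝ, QSpace k)) (𝓘(ℝ, EM).prod 𝓘(ℝ, EM)) ∞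
    (fun v : TotalSpace (QSpace k) V => (⟨v.1, ρ v.1 v.2⟩ : TangentBundle 𝓘(ℝ, EM) M))
  surjective : ∀ x, Function.Surjective (ρ x)
  kernel : ∀ x, ∀ J ∈ admissible k V x, ∀ W : Submodule ℝ (V x),
    W ≤ LinearMap.ker (ρ x) → (∀ w ∈ W, J w ∈ W) → W = ⊥

/-! ### Connections -/

variable [∀ x, IsTopologicalAddGroup (V x)] [∀ x, ContinuousSMul ℝ (V x)]

/-- The local connection form of `∇` with respect to the trivialization `e`: if `q ∈ ℍᵏ` and `s` is
the section of `V` which `e` maps to the constant `q`, then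
`connForm ∇ e x X q` is the image under `e` of `(∇_X s)(x)`. -/
def connForm (nabla : CovariantDerivative 𝓘(ℝ, EM) (QSpace k) V)
    (e : Trivialization (QSpace k) (π (QSpace k) V)) [MemTrivializationAtlas e]
    (x : M) (X : TangentSpace 𝓘(ℝ, EM) x) (q : QSpace k) : QSpace k :=
  e.linearMapAt ℝ x (nabla (fun y => e.symmₗ ℝ y q) x X)

/-- The connection `∇` is compatible with the structural group `Sp(1)·GL(k,ℍ)`: its local connection
forms take values in the Lie algebra of this group, that is, in the space of maps `q ↦ p q + q B`
with `p` an imaginary quaternion and `B` a quaternionic matrix. -/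
def IsCompatible (nabla : CovariantDerivative 𝓘(ℝ, EM) (QSpace k) V) : Prop :=
  ∀ (e : Trivialization (QSpace k) (π (QSpace k) V)) [MemTrivializationAtlas e],
    ∀ x ∈ e.baseSet, ∀ X : TangentSpace 𝓘(ℝ, EM) x,
      ∃ (p : EuclideanSpace ℝ (Fin 3)) (B : Matrix (Fin k) (Fin k) ℍ[ℝ]), ∀ q : QSpace k,
        connForm nabla e x X q = leftMul k (imQ p) q + Matrix.vecMul q B

variable (EM k) in
/-- `s` is a smooth section of `V` over `U`. -/
def IsSmoothSectionOn (s : ∀ x, V x) (U : Set M) : Prop :=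
  ContMDiffOn 𝓘(ℝ, EM) (𝓘(ℝ, EM).prod 𝓘(ℝ, QSpace k)) ∞ (fun x => TotalSpace.mk' (QSpace k) x (s x)) U

/-- The connection `∇` on `V` is torsion free with respect to `ρ : V → TM`:
`ρ ∘ (∇_{ρ ∘ s₁} s₂ - ∇_{ρ ∘ s₂} s₁) - [ρ ∘ s₁, ρ ∘ s₂] = 0` for all local sections `s₁, s₂`. -/
def IsTorsionFree (nabla : CovariantDerivative 𝓘(ℝ, EM) (QSpace k) V)
    (ρ : ∀ x : M, V x →ₗ[ℝ] TangentSpace 𝓘(ℝ, EM) x) : Prop :=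
  ∀ (U : Set M) (s₁ s₂ : ∀ x, V x), IsOpen U →
    IsSmoothSectionOn EM k s₁ U → IsSmoothSectionOn EM k s₂ U → ∀ x ∈ U,
      ρ x (nabla s₂ x (ρ x (s₁ x)) - nabla s₁ x (ρ x (s₂ x)))
        - VectorField.mlieBracket 𝓘(ℝ, EM) (fun y => ρ y (s₁ y)) (fun y => ρ y (s₂ y)) x = 0

/-- The section `R(X, Y) s = ∇_X ∇_Y s - ∇_Y ∇_X s - ∇_{[X, Y]} s`, for vector fields `X, Y` on `M`
and a section `s` of `V`. -/
def curvatureOfFields (nabla : CovariantDerivative 𝓘(ℝ, EM) (QSpace k) V)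
    (X Y : ∀ x : M, TangentSpace 𝓘(ℝ, EM) x) (s : ∀ x, V x) (x : M) : V x :=
  nabla (fun y => nabla s y (Y y)) x (X x) - nabla (fun y => nabla s y (X y)) x (Y x)
    - nabla s x (VectorField.mlieBracket 𝓘(ℝ, EM) X Y x)

/-- The curvature form `R` of `∇` at `x`, evaluated on `X, Y ∈ T_xM` and `v ∈ V x`: the value at `x`
of `R(X, Y) v` computed with extensions of `X, Y, v` which are smooth near `x` (the choice is
irrelevant, as the curvature is tensorial). -/
def curvature (nabla : CovariantDerivative 𝓘(ℝ, EM) (QSpace k) V)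
    (x : M) (X Y : TangentSpace 𝓘(ℝ, EM) x) (v : V x) : V x :=
  curvatureOfFields nabla (FiberBundle.extend EM X) (FiberBundle.extend EM Y)
    (FiberBundle.extend (QSpace k) v) x

/-- The complex multilinear extension of `(e₁, e₂, e₃) ↦ R(ρ(e₁), ρ(e₂)) e₃`. -/
def curvatureRhoC
    (nabla : CovariantDerivative 𝓘(ℝ, EM) (QSpace k) V)
    (ρ : ∀ x : M, V x →ₗ[ℝ] TangentSpace 𝓘(ℝ, EM) x) (x : M) (e₁ e₂ e₃ : V x × V x) : V x × V x :=
  complexify₂ (fun (f : V x → V x) (v : V x) => f v)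
    (complexify₂ (fun u v => curvature nabla x (ρ x u) (ρ x v)) e₁ e₂) e₃

/-- The connection `∇` satisfies the first Bianchi identity with respect to the bundle `Z` of
admissible linear complex structures of `V`, where `J ∈ Z` is identified with the complex subspace
`E^J = ker (J + i)` of the complexified fibre: `∇` is torsion free and
`R(ρ(e₁), ρ(e₂)) e₃ + R(ρ(e₂), ρ(e₃)) e₁ + R(ρ(e₃), ρ(e₁)) e₂ = 0` for all `J ∈ Z` and
`e₁, e₂, e₃ ∈ E^J`. -/
structure SatisfiesFirstBianchi
    (nabla : CovariantDerivative 𝓘(ℝ, EM) (QSpace k) V)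
    (ρ : ∀ x : M, V x →ₗ[ℝ] TangentSpace 𝓘(ℝ, EM) x) : Prop where
  torsionFree : IsTorsionFree nabla ρ
  bianchi : ∀ x, ∀ J ∈ admissible k V x, ∀ e₁ ∈ kerAddI J, ∀ e₂ ∈ kerAddI J, ∀ e₃ ∈ kerAddI J,
    curvatureRhoC nabla ρ x e₁ e₂ e₃ + curvatureRhoC nabla ρ x e₂ e₃ e₁
      + curvatureRhoC nabla ρ x e₃ e₁ e₂ = 0

/-! ### The almost co-CR structure on the bundle of admissible linear complex structures

Over the base set of a trivialization `e` of the atlas of `V`, the bundle `Z` is identified with a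
product with `S2`, through `(x, a) ↦ (x, trivJ e x a)`. These identifications are the
trivializations of the associated bundle `Z`, and all the objects below are written in them. -/

/-- The tangent space to `M × S2`. -/
abbrev TZ (z : M × S2) : Type _ := TangentSpace (𝓘(ℝ, EM).prod (𝓡 2)) z

/-- The differential of the projection `π : Z → M`. -/
def dπ (z : M × S2) (ξ : TZ (EM := EM) z) : TangentSpace 𝓘(ℝ, EM) z.1 :=
  mfderiv (𝓘(ℝ, EM).prod (𝓡 2)) 𝓘(ℝ, EM) (Prod.fst : M × S2 → M) z ξ

/-- The component along `S2` of a vector tangent to `M × S2`, as an imaginary quaternion. -/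
def dS (z : M × S2) (ξ : TZ (EM := EM) z) : ℍ[ℝ] :=
  imQ (mfderiv (𝓘(ℝ, EM).prod (𝓡 2)) 𝓘(ℝ, EuclideanSpace ℝ (Fin 3))
    (fun w : M × S2 => (w.2 : EuclideanSpace ℝ (Fin 3))) z ξ)

/-- `ξ`, tangent to `Z` at `J = (x, a)`, is horizontal with respect to the connection induced by `∇`
on `Z ⊆ End V`: the covariant derivative `∇_{dπ ξ} J(·)` at `x`, of any local section `J(·)` of `Z`
tangent to `ξ` at `x`, is zero. On the section which `e` maps to the constant `q` we have
`(∇_X J) q = v q + Γ(X)(a q) - a (Γ(X) q)`, where `X = dπ ξ`, `v = dS ξ` and `Γ` is the local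
connection form. -/
def IsHorizontal (nabla : CovariantDerivative 𝓘(ℝ, EM) (QSpace k) V)
    (e : Trivialization (QSpace k) (π (QSpace k) V)) [MemTrivializationAtlas e]
    (z : M × S2) (ξ : TZ (EM := EM) z) : Prop :=
  ∀ q : QSpace k, leftMul k (dS z ξ) q
    + connForm nabla e z.1 (dπ z ξ) (leftMul k (imQ z.2) q)
    - leftMul k (imQ z.2) (connForm nabla e z.1 (dπ z ξ) q) = 0

/-- The complex subspace `ℬ_J`: the horizontal lift of `ρ (ker (J + i))`. -/
def horB (nabla : CovariantDerivative 𝓘(ℝ, EM) (QSpace k) V)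
    (ρ : ∀ x : M, V x →ₗ[ℝ] TangentSpace 𝓘(ℝ, EM) x)
    (e : Trivialization (QSpace k) (π (QSpace k) V)) [MemTrivializationAtlas e]
    (z : M × S2) : Set (TZ (EM := EM) z × TZ (EM := EM) z) :=
  {ζ | IsHorizontal nabla e z ζ.1 ∧ IsHorizontal nabla e z ζ.2 ∧
    ∃ w ∈ kerAddI (trivJ e z.1 z.2), dπ z ζ.1 = ρ z.1 w.1 ∧ dπ z ζ.2 = ρ z.1 w.2}

/-- The space `(ker dπ)^{0,1}`, with respect to the complex structure `v ↦ a v` (quaternionic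
multiplication; equivalently, the cross product with `a`) of the fibre `S2` at `a`. -/
def vert01 (z : M × S2) : Set (TZ (EM := EM) z × TZ (EM := EM) z) :=
  {ζ | dπ z ζ.1 = 0 ∧ dπ z ζ.2 = 0 ∧
    (dS z ζ.1, dS z ζ.2) ∈ kerAddI (LinearMap.mulLeft ℝ (imQ z.2))}

/-- The complex distribution `𝒞 = (ker dπ)^{0,1} ⊕ ℬ` on `Z`. -/
def distC (nabla : CovariantDerivative 𝓘(ℝ, EM) (QSpace k) V)
    (ρ : ∀ x : M, V x →ₗ[ℝ] TangentSpace 𝓘(ℝ, EM) x)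
    (e : Trivialization (QSpace k) (π (QSpace k) V)) [MemTrivializationAtlas e]
    (z : M × S2) : Set (TZ (EM := EM) z × TZ (EM := EM) z) :=
  {ζ | ∃ v ∈ vert01 z, ∃ b ∈ horB nabla ρ e z, ζ = v + b}

/-- `X` is a smooth vector field on `O ⊆ M × S2`. -/
def IsSmoothFieldOn (X : ∀ z : M × S2, TZ (EM := EM) z) (O : Set (M × S2)) : Prop :=
  ContMDiffOn (𝓘(ℝ, EM).prod (𝓡 2)) (𝓘(ℝ, EM).prod (𝓡 2)).tangent ∞
    (fun z => (⟨z, X z⟩ : TangentBundle (𝓘(ℝ, EM).prod (𝓡 2)) (M × S2))) O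

/-- `X` is a local section of `𝒞`, over `O ⊆ M × S2`: a smooth complex vector field `X.1 + i X.2`
on `O` with values in `𝒞`. -/
def IsSectionOfC (nabla : CovariantDerivative 𝓘(ℝ, EM) (QSpace k) V)
    (ρ : ∀ x : M, V x →ₗ[ℝ] TangentSpace 𝓘(ℝ, EM) x)
    (e : Trivialization (QSpace k) (π (QSpace k) V)) [MemTrivializationAtlas e]
    (O : Set (M × S2))
    (X : (∀ z : M × S2, TZ (EM := EM) z) × (∀ z : M × S2, TZ (EM := EM) z)) : Prop :=
  IsSmoothFieldOn X.1 O ∧ IsSmoothFieldOn X.2 O ∧ ∀ z ∈ O, (X.1 z, X.2 z) ∈ distC nabla ρ e z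

/-- `(V, ρ, ∇)` is integrable: the distribution `𝒞` on `Z` is integrable, that is, the Lie bracket
of any two local sections of `𝒞` takes values in `𝒞`. -/
def IsIntegrable (nabla : CovariantDerivative 𝓘(ℝ, EM) (QSpace k) V)
    (ρ : ∀ x : M, V x →ₗ[ℝ] TangentSpace 𝓘(ℝ, EM) x) : Prop :=
  ∀ (e : Trivialization (QSpace k) (π (QSpace k) V)) [MemTrivializationAtlas e]
    (O : Set (M × S2)), IsOpen O → O ⊆ e.baseSet ×ˢ univ →
    ∀ X Y : (∀ z : M × S2, TZ (EM := EM) z) × (∀ z : M × S2, TZ (EM := EM) z),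
      IsSectionOfC nabla ρ e O X → IsSectionOfC nabla ρ e O Y →
      ∀ z ∈ O,
        ((complexify₂ (VectorField.mlieBracket (𝓘(ℝ, EM).prod (𝓡 2))) X Y).1 z,
          (complexify₂ (VectorField.mlieBracket (𝓘(ℝ, EM).prod (𝓡 2))) X Y).2 z)
          ∈ distC nabla ρ e z

end Bundles

end CoCR

end

/-!
Over a trivialization of `E`, the covariant derivative `∇J` of the tautological section `J` of
`End E` over `Z` sees exactly the vertical part of a vector tangent to `Z`. Hence a complex vector
`ζ` belongs to `𝒞` if and only if its projection to `M` lies in `ρ(E^J)` and `∇J(ζ.2) = J ∇J(ζ.1)`.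
Torsion freeness preserves the first condition under brackets. For the second, the bracket of
covariant derivatives of `J` produces the commutator of `J` with the curvature on `ρ(E^J)`; when
`rank E > 4`, the Bianchi identity and the compatibility of `∇` force this commutator to satisfy
the same equation.
-/

noncomputable section

open Topology VectorField

set_option maxSynthPendingDepth 3

namespace CoCR

section Calculus

variable {E : Type*} [NormedAddCommGroup E] [NormedSpace ℝ E]
  {H : Type*} [TopologicalSpace H] {I : ModelWithCorners ℝ E H}
  {N : Type*} [TopologicalSpace N] [ChartedSpace H N]
  {F : Type*} [NormedAddCommGroup F] [NormedSpace ℝ F]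
  {G : Type*} [NormedAddCommGroup G] [NormedSpace ℝ G]
  {K : Type*} [NormedAddCommGroup K] [NormedSpace ℝ K] {z : N}

lemma mvfderiv_congr {f g : N → F} (h : f =ᶠ[𝓝 z] g) (ξ : TangentSpace I z) :
    mvfderiv I f z ξ = mvfderiv I g z ξ :=
  congrArg (fun L => L ξ) (h.mfderiv_eq (I := I) (I' := 𝓘(ℝ, F)))

lemma mvfderiv_fderiv_comp {f : N → F} {h : F → G} (hh : DifferentiableAt ℝ h (f z))
    (hf : MDiffAt f z) (ξ : TangentSpace I z) :
    mvfderiv I (h ∘ f) z ξ = fderiv ℝ h (f z) (mvfderiv I f z ξ) := by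
  have := mfderiv_comp z hh.mdifferentiableAt hf
  rw [mfderiv_eq_fderiv] at this
  exact congrArg (fun L => L ξ) this

lemma mvfderiv_comp_mfderiv {E' : Type*} [NormedAddCommGroup E'] [NormedSpace ℝ E']
    {H' : Type*} [TopologicalSpace H'] {I' : ModelWithCorners ℝ E' H'}
    {N' : Type*} [TopologicalSpace N'] [ChartedSpace H' N'] {g : N' → N} {w : N'} {f : N → F}
    (hf : MDifferentiableAt I 𝓘(ℝ, F) f (g w)) (hg : MDifferentiableAt I' I g w)
    (ξ : TangentSpace I' w) :
    mvfderiv I' (f ∘ g) w ξ = mvfderiv I f (g w) (mfderiv I' I g w ξ) :=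
  mfderiv_comp_apply w hf hg ξ

lemma mdifferentiableAt_clm_comp (L : F →L[ℝ] G) {f : N → F} (hf : MDiffAt f z) :
    MDifferentiableAt I 𝓘(ℝ, G) (fun y => L (f y)) z :=
  L.differentiableAt.mdifferentiableAt.comp z hf

lemma mvfderiv_clm_comp (L : F →L[ℝ] G) {f : N → F} (hf : MDiffAt f z) (ξ : TangentSpace I z) :
    mvfderiv I (fun y => L (f y)) z ξ = L (mvfderiv I f z ξ) :=
  (mvfderiv_fderiv_comp L.differentiableAt hf ξ).trans (by rw [L.fderiv])

lemma mvfderiv_bilin (B : F →L[ℝ] G →L[ℝ] K) {f : N → F} {g : N → G}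
    (hf : MDiffAt f z) (hg : MDiffAt g z) (ξ : TangentSpace I z) :
    mvfderiv I (fun y => B (f y) (g y)) z ξ =
      B (mvfderiv I f z ξ) (g z) + B (f z) (mvfderiv I g z ξ) := by
  have hp := hf.prodMk_space hg
  have hpair : mvfderiv I (fun y => (f y, g y)) z ξ = (mvfderiv I f z ξ, mvfderiv I g z ξ) :=
    Prod.ext (mvfderiv_clm_comp (ContinuousLinearMap.fst ℝ F G) hp ξ).symm
      (mvfderiv_clm_comp (ContinuousLinearMap.snd ℝ F G) hp ξ).symm
  refine (mvfderiv_fderiv_comp (f := fun y => (f y, g y))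
    (B.isBoundedBilinearMap.differentiableAt _) hp ξ).trans ?_
  rw [hpair, (B.isBoundedBilinearMap.hasFDerivAt (f z, g z)).fderiv,
    IsBoundedBilinearMap.deriv_apply, add_comm]

lemma mvfderiv_clm_apply {f : N → F →L[ℝ] G} {g : N → F} (hf : MDiffAt f z) (hg : MDiffAt g z)
    (ξ : TangentSpace I z) :
    mvfderiv I (fun y => f y (g y)) z ξ = mvfderiv I f z ξ (g z) + f z (mvfderiv I g z ξ) :=
  mvfderiv_bilin (ContinuousLinearMap.id ℝ (F →L[ℝ] G)) hf hg ξ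

lemma mvfderiv_mem {S : Submodule ℝ F} (hS : IsClosed (S : Set F)) {f : N → F}
    (hf : MDiffAt f z) (h : ∀ᶠ y in 𝓝 z, f y ∈ S) (ξ : TangentSpace I z) :
    mvfderiv I f z ξ ∈ S := by
  have hzero : (fun y => S.mkQL (f y)) =ᶠ[𝓝 z] fun _ => 0 :=
    h.mono fun y hy => (Submodule.Quotient.mk_eq_zero S).2 hy
  have h0 := mvfderiv_clm_comp S.mkQL hf ξ
  rw [mvfderiv_congr hzero, mvfderiv_const] at h0
  exact (Submodule.Quotient.mk_eq_zero S).1 h0.symm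

lemma mdifferentiableAt_toContinuousLinearMap [FiniteDimensional ℝ F] {T : N → F →ₗ[ℝ] G}
    (hT : ∀ v, MDifferentiableAt I 𝓘(ℝ, G) (fun y => T y v) z) :
    MDifferentiableAt I 𝓘(ℝ, F →L[ℝ] G) (fun y => (T y).toContinuousLinearMap) z := by
  let b := Module.finBasis ℝ F
  have hsum : (fun y => (T y).toContinuousLinearMap) = ∑ i, fun y =>
      ContinuousLinearMap.smulRightL ℝ F G (b.coord i).toContinuousLinearMap (T y (b i)) := by
    ext y v
    simp only [Finset.sum_apply, sum_apply, LinearMap.coe_toContinuousLinearMap',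
      ContinuousLinearMap.smulRightL_apply_apply, ContinuousLinearMap.smulRight_apply,
      Module.Basis.coord_apply, ← map_smul, ← map_sum, b.sum_repr]
  rw [hsum]
  exact .sum fun i _ => mdifferentiableAt_clm_comp _ (hT (b i))

lemma mdifferentiableAt_of_clm_apply_eq [CompleteSpace F] [FiniteDimensional ℝ G]
    {T : N → F →L[ℝ] G} {u : N → F} (hT : MDiffAt T z)
    (hTu : MDifferentiableAt I 𝓘(ℝ, G) (fun y => T y (u y)) z)
    (hinj : Function.Injective (T z)) : MDifferentiableAt I 𝓘(ℝ, F) u z := by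
  obtain ⟨L, hL⟩ := ContinuousLinearMap.HasLeftInverse.of_injective_of_finiteDimensional hinj
  have hB : MDifferentiableAt I 𝓘(ℝ, F →L[ℝ] F) (fun y => L ∘L T y) z :=
    mdifferentiableAt_const.clm_comp hT
  have hLT : L ∘L T z = 1 := ContinuousLinearMap.ext hL
  have hunit : IsUnit (L ∘L T z) := hLT ▸ isUnit_one
  have hinv : MDifferentiableAt I 𝓘(ℝ, F →L[ℝ] F) (fun y => Ring.inverse (L ∘L T y)) z :=
    (differentiableAt_inverse (𝕜 := ℝ) hunit).mdifferentiableAt.comp z hB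
  refine (hinv.clm_apply (mdifferentiableAt_clm_comp L hTu)).congr_of_eventuallyEq ?_
  filter_upwards [hB.continuousAt.preimage_mem_nhds (Units.isOpen.mem_nhds hunit)] with y hy
  exact (DFunLike.congr_fun (Ring.inverse_mul_cancel _ hy) (u y)).symm

lemma eventually_mdifferentiableAt [IsManifold I 1 N] {f : N → F}
    (hf : ContMDiffAt I 𝓘(ℝ, F) 1 f z) : ∀ᶠ y in 𝓝 z, MDifferentiableAt I 𝓘(ℝ, F) f y :=
  ((contMDiffAt_iff_contMDiffAt_nhds (by simp)).1 hf).mono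
    fun _ hy => hy.mdifferentiableAt one_ne_zero

lemma mvfderiv_eq_fderiv_chart [IsManifold I 1 N] [I.Boundaryless] {f : N → F} {y : N}
    (hy : y ∈ (chartAt H z).source) (hf : MDiffAt f y) (ξ : TangentSpace I y) :
    mvfderiv I f y ξ = fderiv ℝ (f ∘ (extChartAt I z).symm) (extChartAt I z y)
      (mvfderiv I (extChartAt I z) y ξ) := by
  have hy' : y ∈ (extChartAt I z).source := by rwa [extChartAt_source]
  have hsymm : MDifferentiableAt 𝓘(ℝ, E) I (extChartAt I z).symm (extChartAt I z y) := by
    have := mdifferentiableWithinAt_extChartAt_symm (I := I) ((extChartAt I z).map_source hy')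
    rwa [I.range_eq_univ, mdifferentiableWithinAt_univ] at this
  have hg : DifferentiableAt ℝ (f ∘ (extChartAt I z).symm) (extChartAt I z y) := by
    refine MDifferentiableAt.differentiableAt (MDifferentiableAt.comp _ ?_ hsymm)
    rwa [(extChartAt I z).left_inv hy']
  rw [← mvfderiv_fderiv_comp hg (mdifferentiableAt_extChartAt hy)]
  refine mvfderiv_congr ?_ ξ
  filter_upwards [(isOpen_extChartAt_source (I := I) z).mem_nhds hy'] with x hx
  simp only [Function.comp_apply, (extChartAt I z).left_inv hx]

lemma contDiffAt_comp_extChartAt_symm [I.Boundaryless] {n : ℕ∞ω} {f : N → F}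
    (hf : ContMDiffAt I 𝓘(ℝ, F) n f z) :
    ContDiffAt ℝ n (f ∘ (extChartAt I z).symm) (extChartAt I z z) := by
  have := (contMDiffAt_iff.1 hf).2
  rwa [I.range_eq_univ, contDiffWithinAt_univ] at this

variable (I) in
/-- The vector field on the model space which represents `V` in the chart at `z`. -/
def chartField (z : N) (V : ∀ x : N, TangentSpace I x) (p : E) : E :=
  mpullbackWithin 𝓘(ℝ, E) I (extChartAt I z).symm V (range I) p

lemma mvfderiv_extChartAt_eventuallyEq_chartField [IsManifold I 1 N]
    (V : ∀ x : N, TangentSpace I x) :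
    (fun y => mvfderiv I (extChartAt I z) y (V y)) =ᶠ[𝓝 z]
      chartField I z V ∘ extChartAt I z := by
  have h := eventuallyEq_mpullback_mpullbackWithin_extChartAt (I := I) (x := z) (s := univ) V
  rw [nhdsWithin_univ] at h
  filter_upwards [h, extChartAt_source_mem_nhds (I := I) z] with y hVy hy
  rw [hVy]
  exact (isInvertible_mfderiv_extChartAt hy).self_apply_inverse _

variable [I.Boundaryless] [IsManifold I 2 N]

lemma differentiableAt_chartField [CompleteSpace E] {V : ∀ x : N, TangentSpace I x}
    (hV : MDiffAt (T% V) z) :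
    DifferentiableAt ℝ (chartField I z V) (extChartAt I z z) := by
  have h := MDifferentiableWithinAt.differentiableWithinAt_mpullbackWithin_vectorField
    (s := univ) (V := V) (x := z) (I := I) (by rwa [mdifferentiableWithinAt_univ])
  rw [preimage_univ, univ_inter] at h
  change DifferentiableWithinAt ℝ (chartField I z V) (range I) _ at h
  rwa [I.range_eq_univ, differentiableWithinAt_univ] at h

lemma mvfderiv_extChartAt_mlieBracket (V W : ∀ x : N, TangentSpace I x) :
    mvfderiv I (extChartAt I z) z (mlieBracket I V W z) =
      lieBracket ℝ (chartField I z V) (chartField I z W) (extChartAt I z z) := by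
  rw [← mlieBracketWithin_univ, mlieBracketWithin_apply]
  refine ((isInvertible_mfderiv_extChartAt (mem_extChartAt_source z)).self_apply_inverse _).trans ?_
  rw [preimage_univ, univ_inter]
  change lieBracketWithin ℝ (chartField I z V) (chartField I z W) (range I) _ = _
  rw [I.range_eq_univ, lieBracketWithin_univ]

variable {f : N → F}

lemma mvfderiv_apply_eventuallyEq_chart (hf : ContMDiffAt I 𝓘(ℝ, F) 1 f z)
    (V : ∀ x : N, TangentSpace I x) :
    (fun y => mvfderiv I f y (V y)) =ᶠ[𝓝 z]
      (fun p => fderiv ℝ (f ∘ (extChartAt I z).symm) p (chartField I z V p)) ∘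
        extChartAt I z := by
  filter_upwards [eventually_mdifferentiableAt hf, chart_source_mem_nhds H z,
    mvfderiv_extChartAt_eventuallyEq_chartField (I := I) V] with y hfy hy hVy
  rw [mvfderiv_eq_fderiv_chart hy hfy, hVy]
  rfl

variable [CompleteSpace E]

lemma differentiableAt_fderiv_chartField (hf : ContMDiffAt I 𝓘(ℝ, F) 2 f z)
    {V : ∀ x : N, TangentSpace I x} (hV : MDiffAt (T% V) z) :
    DifferentiableAt ℝ (fun p => fderiv ℝ (f ∘ (extChartAt I z).symm) p (chartField I z V p))
      (extChartAt I z z) :=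
  (((contDiffAt_comp_extChartAt_symm hf).fderiv_right one_add_one_eq_two.le).differentiableAt
    one_ne_zero).clm_apply (differentiableAt_chartField hV)

lemma mdifferentiableAt_mvfderiv_apply (hf : ContMDiffAt I 𝓘(ℝ, F) 2 f z)
    {V : ∀ x : N, TangentSpace I x} (hV : MDiffAt (T% V) z) :
    MDifferentiableAt I 𝓘(ℝ, F) (fun y => mvfderiv I f y (V y)) z :=
  ((differentiableAt_fderiv_chartField hf hV).mdifferentiableAt.comp z
    (mdifferentiableAt_extChartAt (mem_chart_source H z))).congr_of_eventuallyEq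
    (mvfderiv_apply_eventuallyEq_chart (hf.of_le one_le_two) V)

lemma mvfderiv_mvfderiv_apply_eq_chart (hf : ContMDiffAt I 𝓘(ℝ, F) 2 f z)
    (V : ∀ x : N, TangentSpace I x) {W : ∀ x : N, TangentSpace I x} (hW : MDiffAt (T% W) z) :
    mvfderiv I (fun y => mvfderiv I f y (W y)) z (V z) =
      fderiv ℝ (fun p => fderiv ℝ (f ∘ (extChartAt I z).symm) p (chartField I z W p))
        (extChartAt I z z) (chartField I z V (extChartAt I z z)) := by
  rw [mvfderiv_congr (mvfderiv_apply_eventuallyEq_chart (hf.of_le one_le_two) W),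
    mvfderiv_fderiv_comp (differentiableAt_fderiv_chartField hf hW)
      (mdifferentiableAt_extChartAt (mem_chart_source H z)),
    (mvfderiv_extChartAt_eventuallyEq_chartField V).eq_of_nhds, Function.comp_apply]

lemma mvfderiv_apply_mlieBracket (hf : ContMDiffAt I 𝓘(ℝ, F) 2 f z)
    {V W : ∀ x : N, TangentSpace I x} (hV : MDiffAt (T% V) z) (hW : MDiffAt (T% W) z) :
    mvfderiv I f z (mlieBracket I V W z) =
      mvfderiv I (fun y => mvfderiv I f y (W y)) z (V z)
        - mvfderiv I (fun y => mvfderiv I f y (V y)) z (W z) := by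
  rw [mvfderiv_mvfderiv_apply_eq_chart hf V hW, mvfderiv_mvfderiv_apply_eq_chart hf W hV,
    ← fderiv_apply_lieBracket (contDiffAt_comp_extChartAt_symm hf) (by simp)
      (differentiableAt_chartField hW) (differentiableAt_chartField hV),
    mvfderiv_eq_fderiv_chart (mem_chart_source H z) (hf.mdifferentiableAt two_ne_zero),
    mvfderiv_extChartAt_mlieBracket]

end Calculus

attribute [local instance] LieRing.ofAssociativeRing LieAlgebra.ofAssociativeAlgebra

/-- A one-form on `N` with values in `End Q`, written `ξ ↦ form z (d base ξ)` in terms of the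
differential of a map `base` (in the applications, coordinates on a manifold over which `N` lies).
It stands for the connection `d + form (d base)` on the trivial bundle over `N` with fibre `Q`. -/
structure ConnectionForm (N B Q : Type*) [NormedAddCommGroup B] [NormedSpace ℝ B]
    [NormedAddCommGroup Q] [NormedSpace ℝ Q] where
  base : N → B
  form : N → B →L[ℝ] Q →L[ℝ] Q

namespace ConnectionForm

variable {E : Type*} [NormedAddCommGroup E] [NormedSpace ℝ E]
  {H : Type*} [TopologicalSpace H] {I : ModelWithCorners ℝ E H}
  {N : Type*} [TopologicalSpace N] [ChartedSpace H N]
  {B : Type*} [NormedAddCommGroup B] [NormedSpace ℝ B]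
  {Q : Type*} [NormedAddCommGroup Q] [NormedSpace ℝ Q] {z : N}

variable (I) in
/-- The value of a connection form on a tangent vector. -/
def oneForm (A : ConnectionForm N B Q) (z : N) (ξ : TangentSpace I z) : Q →L[ℝ] Q :=
  A.form z (mvfderiv I A.base z ξ)

variable (I) in
/-- The covariant derivative `∇_ξ s = ds(ξ) + A(ξ) s`. -/
def covDeriv (A : ConnectionForm N B Q) (s : N → Q) (z : N) (ξ : TangentSpace I z) : Q :=
  mvfderiv I s z ξ + A.oneForm I z ξ (s z)

variable (I) in
/-- The curvature `dA + A ∧ A`. As the one-form is `form (d base)` and `d (d base) = 0`, only the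
derivative of `form` enters `dA`. -/
def curv (A : ConnectionForm N B Q) (z : N) (ξ η : TangentSpace I z) : Q →L[ℝ] Q :=
  mvfderiv I A.form z ξ (mvfderiv I A.base z η) - mvfderiv I A.form z η (mvfderiv I A.base z ξ)
    + ⁅A.oneForm I z ξ, A.oneForm I z η⁆

variable (I) in
/-- The regularity at `z` under which the curvature computes the commutator of covariant
derivatives. -/
structure IsRegularAt (A : ConnectionForm N B Q) (z : N) : Prop where
  base : ContMDiffAt I 𝓘(ℝ, B) 2 A.base z
  form : MDifferentiableAt I 𝓘(ℝ, B →L[ℝ] Q →L[ℝ] Q) A.form z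

/-- The connection induced on endomorphisms, `∇_ξ T = dT(ξ) + ⁅A(ξ), T⁆`. -/
def ad (A : ConnectionForm N B Q) : ConnectionForm N B (Q →L[ℝ] Q) where
  base := A.base
  form z := (ContinuousLinearMap.mul ℝ (Q →L[ℝ] Q) -
    (ContinuousLinearMap.mul ℝ (Q →L[ℝ] Q)).flip) ∘L A.form z

/-- The pullback of a connection form under a map. -/
def pullback {N' : Type*} (A : ConnectionForm N B Q) (g : N' → N) : ConnectionForm N' B Q where
  base := A.base ∘ g
  form := A.form ∘ g

variable {A : ConnectionForm N B Q}

lemma oneForm_add (ξ η : TangentSpace I z) :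
    A.oneForm I z (ξ + η) = A.oneForm I z ξ + A.oneForm I z η := by
  simp only [oneForm, map_add]

lemma covDeriv_add (s : N → Q) (ξ η : TangentSpace I z) :
    A.covDeriv I s z (ξ + η) = A.covDeriv I s z ξ + A.covDeriv I s z η := by
  simp only [covDeriv, oneForm_add, map_add, add_apply]
  abel

lemma covDeriv_sub (s : N → Q) (ξ η : TangentSpace I z) :
    A.covDeriv I s z (ξ - η) = A.covDeriv I s z ξ - A.covDeriv I s z η := by
  rw [eq_sub_iff_add_eq, ← covDeriv_add, sub_add_cancel]

lemma covDeriv_congr {s t : N → Q} (h : s =ᶠ[𝓝 z] t) (ξ : TangentSpace I z) :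
    A.covDeriv I s z ξ = A.covDeriv I t z ξ := by
  rw [covDeriv, covDeriv, mvfderiv_congr h, h.self_of_nhds]

lemma oneForm_ad (ξ : TangentSpace I z) (T : Q →L[ℝ] Q) :
    A.ad.oneForm I z ξ T = ⁅A.oneForm I z ξ, T⁆ :=
  rfl

lemma IsRegularAt.ad (hA : A.IsRegularAt I z) : A.ad.IsRegularAt I z :=
  ⟨hA.base, mdifferentiableAt_const.clm_comp hA.form⟩

lemma curv_ad (hA : A.IsRegularAt I z) (ξ η : TangentSpace I z) (T : Q →L[ℝ] Q) :
    A.ad.curv I z ξ η T = ⁅A.curv I z ξ η, T⁆ := by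
  have hform : ∀ ξ : TangentSpace I z, ∀ b, mvfderiv I A.ad.form z ξ b T =
      ⁅mvfderiv I A.form z ξ b, T⁆ := fun ξ b => by
    have h := mvfderiv_clm_comp (ContinuousLinearMap.compL ℝ B (Q →L[ℝ] Q) _
      (ContinuousLinearMap.mul ℝ (Q →L[ℝ] Q) -
        (ContinuousLinearMap.mul ℝ (Q →L[ℝ] Q)).flip)) hA.form ξ
    exact congrArg (fun L => L b T) h
  rw [curv, curv, add_lie, sub_lie, ← hform, ← hform, lie_lie, Ring.lie_def (A.ad.oneForm I z ξ)]
  rfl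

lemma curv_mem {𝔤 : LieSubalgebra ℝ (Q →L[ℝ] Q)} (h𝔤 : IsClosed (𝔤 : Set (Q →L[ℝ] Q)))
    (hA : A.IsRegularAt I z) (hmem : ∀ᶠ y in 𝓝 z, ∀ b, A.form y b ∈ 𝔤)
    (ξ η : TangentSpace I z) : A.curv I z ξ η ∈ 𝔤 := by
  have hform : ∀ ξ : TangentSpace I z, ∀ b, mvfderiv I A.form z ξ b ∈ 𝔤 := fun ξ b => by
    have h := mvfderiv_clm_comp (ContinuousLinearMap.apply ℝ (Q →L[ℝ] Q) b) hA.form ξ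
    have hmem' := mvfderiv_mem (S := 𝔤.toSubmodule) h𝔤 (mdifferentiableAt_clm_comp
      (ContinuousLinearMap.apply ℝ (Q →L[ℝ] Q) b) hA.form) (hmem.mono fun y hy => hy b) ξ
    rwa [h] at hmem'
  exact add_mem (sub_mem (hform _ _) (hform _ _))
    (𝔤.lie_mem (hmem.self_of_nhds _) (hmem.self_of_nhds _))

section Pullback

variable {E' : Type*} [NormedAddCommGroup E'] [NormedSpace ℝ E']
  {H' : Type*} [TopologicalSpace H'] {I' : ModelWithCorners ℝ E' H'}
  {N' : Type*} [TopologicalSpace N'] [ChartedSpace H' N'] {g : N' → N} {w : N'}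

lemma oneForm_pullback (hA : MDiffAt A.base (g w)) (hg : MDifferentiableAt I' I g w)
    (ξ : TangentSpace I' w) :
    (A.pullback g).oneForm I' w ξ = A.oneForm I (g w) (mfderiv I' I g w ξ) := by
  simp only [oneForm, pullback, Function.comp_apply, mvfderiv_comp_mfderiv hA hg]

lemma curv_pullback (hA : A.IsRegularAt I (g w)) (hg : MDifferentiableAt I' I g w)
    (ξ η : TangentSpace I' w) :
    (A.pullback g).curv I' w ξ η =
      A.curv I (g w) (mfderiv I' I g w ξ) (mfderiv I' I g w η) := by
  have hbase := hA.base.mdifferentiableAt two_ne_zero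
  rw [curv, curv, oneForm_pullback hbase hg, oneForm_pullback hbase hg]
  simp only [pullback, mvfderiv_comp_mfderiv hbase hg, mvfderiv_comp_mfderiv hA.form hg]

lemma IsRegularAt.pullback (hA : A.IsRegularAt I (g w)) (hg : ContMDiffAt I' I 2 g w) :
    (A.pullback g).IsRegularAt I' w :=
  ⟨hA.base.comp w hg, hA.form.comp w (hg.mdifferentiableAt two_ne_zero)⟩

end Pullback

lemma covDeriv_clm_apply {T : N → Q →L[ℝ] Q} {s : N → Q} (hT : MDiffAt T z) (hs : MDiffAt s z)
    (ξ : TangentSpace I z) :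
    A.covDeriv I (fun y => T y (s y)) z ξ =
      A.ad.covDeriv I T z ξ (s z) + T z (A.covDeriv I s z ξ) := by
  simp only [covDeriv, oneForm_ad, Ring.lie_def, mvfderiv_clm_apply hT hs, add_apply, sub_apply,
    mul_apply_eq_comp, map_add]
  abel

lemma covDeriv_ad_mul {S T : N → Q →L[ℝ] Q} (hS : MDiffAt S z) (hT : MDiffAt T z)
    (ξ : TangentSpace I z) :
    A.ad.covDeriv I (fun y => S y * T y) z ξ =
      A.ad.covDeriv I S z ξ * T z + S z * A.ad.covDeriv I T z ξ := by
  have hST := mvfderiv_bilin (ContinuousLinearMap.mul ℝ (Q →L[ℝ] Q)) hS hT ξ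
  simp only [ContinuousLinearMap.mul_apply'] at hST
  simp only [covDeriv, oneForm_ad, Ring.lie_def, hST]
  noncomm_ring

variable [CompleteSpace E] [I.Boundaryless] [IsManifold I 2 N]

lemma IsRegularAt.mdifferentiableAt_oneForm_apply (hA : A.IsRegularAt I z)
    {X : ∀ y : N, TangentSpace I y} (hX : MDiffAt (T% X) z) :
    MDifferentiableAt I 𝓘(ℝ, Q →L[ℝ] Q) (fun y => A.oneForm I y (X y)) z :=
  hA.form.clm_apply (mdifferentiableAt_mvfderiv_apply hA.base hX)

lemma IsRegularAt.mdifferentiableAt_covDeriv_apply (hA : A.IsRegularAt I z) {s : N → Q}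
    (hs : ContMDiffAt I 𝓘(ℝ, Q) 2 s z) {X : ∀ y : N, TangentSpace I y} (hX : MDiffAt (T% X) z) :
    MDifferentiableAt I 𝓘(ℝ, Q) (fun y => A.covDeriv I s y (X y)) z :=
  (mdifferentiableAt_mvfderiv_apply hs hX).add
    ((hA.mdifferentiableAt_oneForm_apply hX).clm_apply (hs.mdifferentiableAt two_ne_zero))

lemma IsRegularAt.covDeriv_covDeriv_apply (hA : A.IsRegularAt I z) {s : N → Q}
    (hs : ContMDiffAt I 𝓘(ℝ, Q) 2 s z) (X : ∀ y : N, TangentSpace I y)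
    {Y : ∀ y : N, TangentSpace I y} (hY : MDiffAt (T% Y) z) :
    A.covDeriv I (fun y => A.covDeriv I s y (Y y)) z (X z) =
      mvfderiv I (fun y => mvfderiv I s y (Y y)) z (X z)
        + mvfderiv I A.form z (X z) (mvfderiv I A.base z (Y z)) (s z)
        + A.form z (mvfderiv I (fun y => mvfderiv I A.base y (Y y)) z (X z)) (s z)
        + A.oneForm I z (Y z) (mvfderiv I s z (X z))
        + A.oneForm I z (X z) (A.covDeriv I s z (Y z)) := by
  have hs' := hs.mdifferentiableAt two_ne_zero
  have hdY := mdifferentiableAt_mvfderiv_apply hA.base hY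
  have hAY := hA.mdifferentiableAt_oneForm_apply hY
  have hsum := congrArg (fun L => L (X z))
    (mvfderiv_fun_add (mdifferentiableAt_mvfderiv_apply hs hY) (hAY.clm_apply hs'))
  rw [add_apply, mvfderiv_clm_apply hAY hs'] at hsum
  have hform : mvfderiv I (fun y => A.oneForm I y (Y y)) z (X z) =
      mvfderiv I A.form z (X z) (mvfderiv I A.base z (Y z)) +
        A.form z (mvfderiv I (fun y => mvfderiv I A.base y (Y y)) z (X z)) :=
    mvfderiv_clm_apply hA.form hdY (X z)
  rw [covDeriv]
  simp only [covDeriv, hsum, hform, add_apply, add_assoc]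

lemma IsRegularAt.commutator_covDeriv (hA : A.IsRegularAt I z) {s : N → Q}
    (hs : ContMDiffAt I 𝓘(ℝ, Q) 2 s z) {X Y : ∀ y : N, TangentSpace I y}
    (hX : MDiffAt (T% X) z) (hY : MDiffAt (T% Y) z) :
    A.covDeriv I (fun y => A.covDeriv I s y (Y y)) z (X z)
        - A.covDeriv I (fun y => A.covDeriv I s y (X y)) z (Y z)
        - A.covDeriv I s z (mlieBracket I X Y z) = A.curv I z (X z) (Y z) (s z) := by
  have hbracket : A.covDeriv I s z (mlieBracket I X Y z) =
      mvfderiv I (fun y => mvfderiv I s y (Y y)) z (X z)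
        - mvfderiv I (fun y => mvfderiv I s y (X y)) z (Y z)
        + A.form z (mvfderiv I (fun y => mvfderiv I A.base y (Y y)) z (X z)
          - mvfderiv I (fun y => mvfderiv I A.base y (X y)) z (Y z)) (s z) := by
    rw [covDeriv, oneForm, mvfderiv_apply_mlieBracket hs hX hY,
      mvfderiv_apply_mlieBracket hA.base hX hY]
  rw [hbracket, hA.covDeriv_covDeriv_apply hs X hY, hA.covDeriv_covDeriv_apply hs Y hX]
  simp only [covDeriv, curv, Ring.lie_def, map_add, map_sub, add_apply, sub_apply,
    mul_apply_eq_comp]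
  abel

end ConnectionForm

section TwistorDistribution

variable {E : Type*} [NormedAddCommGroup E] [NormedSpace ℝ E]
  {H : Type*} [TopologicalSpace H] {I : ModelWithCorners ℝ E H}
  {N : Type*} [TopologicalSpace N] [ChartedSpace H N]
  {B : Type*} [NormedAddCommGroup B] [NormedSpace ℝ B]
  {Q : Type*} [NormedAddCommGroup Q] [NormedSpace ℝ Q]

variable (I) in
/-- For a field `J` of complex structures on `Q` over `N` and an anchor `R`, the complex tangent
vectors `ζ.1 + i ζ.2` whose image under `d base` lies in `R (ker (J + i))` and along which the
covariant derivative of `J` is of type `(0, 1)`. It is the abstract form of the distribution `𝒞`. -/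
def twistorDist (A : ConnectionForm N B Q) (R : N → Q →L[ℝ] B) (J : N → Q →L[ℝ] Q) (z : N) :
    Set (TangentSpace I z × TangentSpace I z) :=
  {ζ | A.ad.covDeriv I J z ζ.2 = J z * A.ad.covDeriv I J z ζ.1 ∧
    ∃ u, mvfderiv I A.base z ζ.1 = R z u ∧ mvfderiv I A.base z ζ.2 = R z (J z u)}

variable (I) in
/-- Torsion freeness at `z` of a connection form with respect to the anchor `R`, tested on constant
sections. -/
def IsTorsionFreeAt (A : ConnectionForm N B Q) (R : N → Q →L[ℝ] B) (z : N) : Prop :=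
  ∀ (ξ η : TangentSpace I z) (p q : Q), mvfderiv I A.base z ξ = R z p →
    mvfderiv I A.base z η = R z q →
      R z (A.oneForm I z ξ q - A.oneForm I z η p) = mvfderiv I R z ξ q - mvfderiv I R z η p

variable (I) in
/-- The local data of a torsion free connection on an almost co-CR quaternionic manifold, seen from
the twistor space: the anchor `R` is injective on `ker (J + i)`. -/
structure IsTorsionFreeCoCRAt (A : ConnectionForm N B Q) (R : N → Q →L[ℝ] B) (J : N → Q →L[ℝ] Q)
    (z : N) : Prop where
  regular : A.IsRegularAt I z
  anchor : MDifferentiableAt I 𝓘(ℝ, Q →L[ℝ] B) R z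
  smooth : ContMDiffAt I 𝓘(ℝ, Q →L[ℝ] Q) 2 J z
  sq : ∀ᶠ y in 𝓝 z, J y * J y = -1
  torsionFree : IsTorsionFreeAt I A R z
  injective : ∀ w, R z w = 0 → R z (J z w) = 0 → w = 0

variable [IsManifold I 2 N]

variable (I) in
/-- The complex vector field `X.1 + i X.2` is differentiable at `z`, and a section of `D` near
`z`. -/
structure IsSectionAt (D : ∀ y : N, Set (TangentSpace I y × TangentSpace I y))
    (X : (∀ y : N, TangentSpace I y) × (∀ y : N, TangentSpace I y)) (z : N) : Prop where
  fst : MDiffAt (T% X.1) z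
  snd : MDiffAt (T% X.2) z
  mem : ∀ᶠ y in 𝓝 z, (X.1 y, X.2 y) ∈ D y

variable {A : ConnectionForm N B Q} {R : N → Q →L[ℝ] B} {J : N → Q →L[ℝ] Q} {z : N}
  [CompleteSpace E] [I.Boundaryless]

lemma mvfderiv_base_mlieBracket (hA : A.IsRegularAt I z) (hR : MDiffAt R z)
    (hT : IsTorsionFreeAt I A R z) {X Y : ∀ y : N, TangentSpace I y} (hX : MDiffAt (T% X) z)
    (hY : MDiffAt (T% Y) z) {p q : N → Q} (hp : MDiffAt p z) (hq : MDiffAt q z)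
    (hXp : ∀ᶠ y in 𝓝 z, mvfderiv I A.base y (X y) = R y (p y))
    (hYq : ∀ᶠ y in 𝓝 z, mvfderiv I A.base y (Y y) = R y (q y)) :
    mvfderiv I A.base z (mlieBracket I X Y z) =
      R z (A.covDeriv I q z (X z) - A.covDeriv I p z (Y z)) := by
  have h := hT _ _ _ _ hXp.self_of_nhds hYq.self_of_nhds
  rw [mvfderiv_apply_mlieBracket hA.base hX hY, mvfderiv_congr hXp, mvfderiv_congr hYq,
    mvfderiv_clm_apply hR hq, mvfderiv_clm_apply hR hp, add_sub_add_comm, ← h, ← map_sub,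
    ← map_add, ConnectionForm.covDeriv, ConnectionForm.covDeriv]
  congr 1
  abel

namespace IsTorsionFreeCoCRAt

lemma exists_mdifferentiableAt_lift [CompleteSpace Q] [FiniteDimensional ℝ B]
    (h : IsTorsionFreeCoCRAt I A R J z)
    {X : (∀ y : N, TangentSpace I y) × (∀ y : N, TangentSpace I y)}
    (hX : IsSectionAt I (twistorDist I A R J) X z) :
    ∃ u : N → Q, MDifferentiableAt I 𝓘(ℝ, Q) u z ∧
      (∀ᶠ y in 𝓝 z, mvfderiv I A.base y (X.1 y) = R y (u y)) ∧
      ∀ᶠ y in 𝓝 z, mvfderiv I A.base y (X.2 y) = R y (J y (u y)) := by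
  have hlift : ∀ᶠ y in 𝓝 z, ∃ u, mvfderiv I A.base y (X.1 y) = R y u ∧
      mvfderiv I A.base y (X.2 y) = R y (J y u) := hX.mem.mono fun y hy => hy.2
  obtain ⟨u, hu⟩ := Filter.skolem.1 hlift
  have hXu := hu.mono fun y hy => hy.1
  have hXJu := hu.mono fun y hy => hy.2
  let T : N → Q →L[ℝ] B × B := fun y =>
    .inl ℝ B B ∘L R y + .inr ℝ B B ∘L (R y ∘L J y)
  have hT : MDifferentiableAt I 𝓘(ℝ, Q →L[ℝ] B × B) T z :=
    (mdifferentiableAt_const.clm_comp h.anchor).add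
      (mdifferentiableAt_const.clm_comp
        (h.anchor.clm_comp (h.smooth.mdifferentiableAt two_ne_zero)))
  have hT_apply : ∀ y w, T y w = (R y w, R y (J y w)) := fun y w => by simp [T]
  refine ⟨u, mdifferentiableAt_of_clm_apply_eq hT ?_ ?_, hXu, hXJu⟩
  · refine ((mdifferentiableAt_mvfderiv_apply h.regular.base hX.fst).prodMk_space
      (mdifferentiableAt_mvfderiv_apply h.regular.base hX.snd)).congr_of_eventuallyEq ?_
    filter_upwards [hu] with y hy
    rw [hT_apply, hy.1, hy.2]
  · refine (injective_iff_map_eq_zero (T z)).2 fun w hw => ?_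
    rw [hT_apply, Prod.mk_eq_zero] at hw
    exact h.injective w hw.1 hw.2

variable {X Y : (∀ y : N, TangentSpace I y) × (∀ y : N, TangentSpace I y)}

lemma exists_mvfderiv_base_complexify₂_mlieBracket [CompleteSpace Q] [FiniteDimensional ℝ B]
    (h : IsTorsionFreeCoCRAt I A R J z) (hX : IsSectionAt I (twistorDist I A R J) X z)
    (hY : IsSectionAt I (twistorDist I A R J) Y z) :
    ∃ w, mvfderiv I A.base z ((complexify₂ (mlieBracket I) X Y).1 z) = R z w ∧
      mvfderiv I A.base z ((complexify₂ (mlieBracket I) X Y).2 z) = R z (J z w) := by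
  obtain ⟨u, hu, hXu, hXJu⟩ := h.exists_mdifferentiableAt_lift hX
  obtain ⟨v, hv, hYv, hYJv⟩ := h.exists_mdifferentiableAt_lift hY
  have hJ := h.smooth.mdifferentiableAt two_ne_zero
  have hJu := hJ.clm_apply hu
  have hJv := hJ.clm_apply hv
  have hX₂ := hX.mem.self_of_nhds.1
  have hY₂ := hY.mem.self_of_nhds.1
  have hbracket {X Y p q} := mvfderiv_base_mlieBracket (X := X) (Y := Y) (p := p) (q := q)
    h.regular h.anchor h.torsionFree
  refine ⟨A.covDeriv I v z (X.1 z) - A.covDeriv I u z (Y.1 z) -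
    (A.covDeriv I (fun y => J y (v y)) z (X.2 z) -
      A.covDeriv I (fun y => J y (u y)) z (Y.2 z)), ?_, ?_⟩
  · simp only [complexify₂, Pi.sub_apply]
    rw [map_sub, hbracket hX.fst hY.fst hu hv hXu hYv,
      hbracket hX.snd hY.snd hJu hJv hXJu hYJv, ← map_sub]
  · have hsq : ∀ w, J z (J z w) = -w := fun w => DFunLike.congr_fun h.sq.self_of_nhds w
    simp only [complexify₂, Pi.add_apply]
    rw [map_add, hbracket hX.fst hY.snd hu hJv hXu hYJv,
      hbracket hX.snd hY.fst hJu hv hXJu hYv, ← map_add]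
    congr 1
    simp only [ConnectionForm.covDeriv_clm_apply hJ hu, ConnectionForm.covDeriv_clm_apply hJ hv,
      hX₂, hY₂, mul_apply_eq_comp, map_sub, map_add, hsq]
    abel

lemma covDeriv_ad_mlieBracket (h : IsTorsionFreeCoCRAt I A R J z)
    {X Y : ∀ y : N, TangentSpace I y} (hX : MDiffAt (T% X) z) (hY : MDiffAt (T% Y) z) :
    A.ad.covDeriv I J z (mlieBracket I X Y z) =
      A.ad.covDeriv I (fun y => A.ad.covDeriv I J y (Y y)) z (X z)
        - A.ad.covDeriv I (fun y => A.ad.covDeriv I J y (X y)) z (Y z)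
        - ⁅A.curv I z (X z) (Y z), J z⁆ := by
  rw [← ConnectionForm.curv_ad h.regular, ← h.regular.ad.commutator_covDeriv h.smooth hX hY,
    sub_sub_cancel]

lemma covDeriv_ad_snd (h : IsTorsionFreeCoCRAt I A R J z)
    (hX : IsSectionAt I (twistorDist I A R J) X z) (ξ : TangentSpace I z) :
    A.ad.covDeriv I (fun y => A.ad.covDeriv I J y (X.2 y)) z ξ =
      A.ad.covDeriv I J z ξ * A.ad.covDeriv I J z (X.1 z)
        + J z * A.ad.covDeriv I (fun y => A.ad.covDeriv I J y (X.1 y)) z ξ := by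
  rw [ConnectionForm.covDeriv_congr (hX.mem.mono fun y hy => hy.1),
    ConnectionForm.covDeriv_ad_mul (h.smooth.mdifferentiableAt two_ne_zero)
      (h.regular.ad.mdifferentiableAt_covDeriv_apply h.smooth hX.fst)]

lemma covDeriv_ad_complexify₂_mlieBracket (h : IsTorsionFreeCoCRAt I A R J z)
    (hX : IsSectionAt I (twistorDist I A R J) X z) (hY : IsSectionAt I (twistorDist I A R J) Y z)
    (hcurv : J z * ⁅(complexify₂ (A.curv I z) (X.1 z, X.2 z) (Y.1 z, Y.2 z)).1, J z⁆ =
      ⁅(complexify₂ (A.curv I z) (X.1 z, X.2 z) (Y.1 z, Y.2 z)).2, J z⁆) :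
    A.ad.covDeriv I J z ((complexify₂ (mlieBracket I) X Y).2 z) =
      J z * A.ad.covDeriv I J z ((complexify₂ (mlieBracket I) X Y).1 z) := by
  have hsq : ∀ S : Q →L[ℝ] Q, J z * (J z * S) = -S := fun S => by
    rw [← mul_assoc, h.sq.self_of_nhds, neg_one_mul]
  simp only [complexify₂, add_lie, sub_lie, mul_sub] at hcurv
  simp only [complexify₂, Pi.sub_apply, Pi.add_apply, ConnectionForm.covDeriv_sub,
    ConnectionForm.covDeriv_add, h.covDeriv_ad_mlieBracket hX.fst hY.fst,
    h.covDeriv_ad_mlieBracket hX.snd hY.snd, h.covDeriv_ad_mlieBracket hX.fst hY.snd,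
    h.covDeriv_ad_mlieBracket hX.snd hY.fst, h.covDeriv_ad_snd hX, h.covDeriv_ad_snd hY,
    hX.mem.self_of_nhds.1, hY.mem.self_of_nhds.1, mul_sub, mul_add, mul_assoc, hsq]
  rw [← sub_eq_zero] at hcurv ⊢
  rw [← hcurv]
  abel

theorem complexify₂_mlieBracket_mem [CompleteSpace Q] [FiniteDimensional ℝ B]
    (h : IsTorsionFreeCoCRAt I A R J z)
    (hcurv : ∀ ξ ∈ twistorDist I A R J z, ∀ η ∈ twistorDist I A R J z,
      J z * ⁅(complexify₂ (A.curv I z) ξ η).1, J z⁆ = ⁅(complexify₂ (A.curv I z) ξ η).2, J z⁆)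
    (hX : IsSectionAt I (twistorDist I A R J) X z)
    (hY : IsSectionAt I (twistorDist I A R J) Y z) :
    ((complexify₂ (mlieBracket I) X Y).1 z, (complexify₂ (mlieBracket I) X Y).2 z) ∈
      twistorDist I A R J z :=
  ⟨h.covDeriv_ad_complexify₂_mlieBracket hX hY
      (hcurv _ hX.mem.self_of_nhds _ hY.mem.self_of_nhds),
    h.exists_mvfderiv_base_complexify₂_mlieBracket hX hY⟩

end IsTorsionFreeCoCRAt

end TwistorDistribution

section QuaternionicAlgebra

lemma star_eq_neg_of_mul_self {a : ℍ[ℝ]} (ha : a * a = -1) : star a = -a := by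
  have hnorm : normSq a * normSq a = 1 := by rw [← map_mul, ha, normSq_neg, map_one]
  have hone : normSq a = 1 := by nlinarith [normSq_nonneg (a := a)]
  rw [star_eq_neg, ← sq_eq_neg_normSq, sq, ha, hone, coe_one]

lemma exists_eq_add_smul_of_commute {a c : ℍ[ℝ]} (ha : a * a = -1) (hc : c * a = a * c) :
    ∃ x y : ℝ, c = x • (1 : ℍ[ℝ]) + y • a := by
  have him : c.im * a = a * c.im := by
    rw [← sub_re_self, sub_mul, mul_sub, hc, coe_commutes]
  have hreal : star (c.im * a) = c.im * a := by
    rw [star_mul, star_eq_neg_of_mul_self ha, star_im, neg_mul_neg, him]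
  refine ⟨c.re, -(c.im * a).re, ?_⟩
  calc c = c.re - c.im * a * a := by rw [mul_assoc, ha, mul_neg_one, sub_neg_eq_add, re_add_im]
    _ = _ := by
      conv_lhs => rw [star_eq_self.1 hreal]
      rw [neg_smul, ← sub_eq_add_neg, coe_mul_eq_smul, ← coe_mul_eq_smul _ (1 : ℍ[ℝ]), mul_one]

/-- Two quaternions anticommuting with `a` have a quotient in `ℝ + ℝ a`. If `m u v` were not zero,
`m u v • w` would thus be in `m u v • S` for every `w`, where `S` is the `(ℝ + ℝ a)`-span of `u`
and `v`, whose dimension is at most four. -/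
lemma eq_zero_of_cyclic_sum_eq_zero {W : Type*} [AddCommGroup W] [Module ℝ W] [Module ℍ[ℝ] W]
    [IsScalarTower ℝ ℍ[ℝ] W] (hrank : 4 < Module.finrank ℝ W) {a : ℍ[ℝ]} (ha : a * a = -1)
    {m : W → W → ℍ[ℝ]} (hm : ∀ u v, m u v * a = -(a * m u v))
    (hcyc : ∀ u v w, m u v • w + m v w • u + m w u • v = 0) (u v : W) : m u v = 0 := by
  by_contra hne
  let S := Submodule.span ℝ (Set.range ![u, a • u, v, a • v])
  have hgen (i : Fin 4) : ![u, a • u, v, a • v] i ∈ S := Submodule.subset_span ⟨i, rfl⟩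
  have hquot (n : ℍ[ℝ]) (hn : n * a = -(a * n)) (w : W) (hw : w ∈ S) (haw : a • w ∈ S) :
      ((m u v)⁻¹ * n) • w ∈ S := by
    have hinv : a * (m u v)⁻¹ = -((m u v)⁻¹ * a) := by
      rw [eq_neg_iff_add_eq_zero, ← mul_right_inj' hne, ← mul_left_inj' hne]
      simp [mul_add, hne, ← mul_assoc (m u v) a, hm]
    obtain ⟨x, y, hxy⟩ := exists_eq_add_smul_of_commute ha
      (show (m u v)⁻¹ * n * a = a * ((m u v)⁻¹ * n) by
        rw [← mul_assoc, hinv, mul_assoc, hn, mul_neg, neg_mul, mul_assoc])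
    rw [hxy, add_smul, smul_assoc, smul_assoc, one_smul]
    exact add_mem (S.smul_mem x hw) (S.smul_mem y haw)
  have htop : S = ⊤ := by
    refine eq_top_iff.2 fun w _ => ?_
    have hw : w = -(((m u v)⁻¹ * m v w) • u + ((m u v)⁻¹ * m w u) • v) := by
      rw [mul_smul, mul_smul, ← smul_add, ← smul_neg, eq_inv_smul_iff₀ hne,
        eq_neg_iff_add_eq_zero, ← add_assoc, hcyc]
    rw [hw]
    exact neg_mem (add_mem (hquot _ (hm v w) u (hgen 0) (hgen 1))
      (hquot _ (hm w u) v (hgen 2) (hgen 3)))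
  have hle : Module.finrank ℝ S ≤ 4 := finrank_range_le_card (R := ℝ) ![u, a • u, v, a • v]
  rw [htop, finrank_top] at hle
  omega

variable {Q : Type*} [NormedAddCommGroup Q] [NormedSpace ℝ Q] [Module ℍ[ℝ] Q]
  [IsBoundedSMul ℍ[ℝ] Q] [IsScalarTower ℝ ℍ[ℝ] Q]

variable (Q) in
/-- The action of the quaternions on an `ℍ`-module `Q` (on `ℍᵏ`, the left multiplication), as a
homomorphism of real algebras. -/
def quatAction : ℍ[ℝ] →ₐ[ℝ] Q →L[ℝ] Q :=
  AlgHom.ofLinearMap (ContinuousLinearMap.lsmul ℝ ℍ[ℝ]).toLinearMap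
    (by ext q; exact one_smul _ q) (fun a b => by ext q; exact mul_smul a b q)

lemma quatAction_apply (a : ℍ[ℝ]) (q : Q) : quatAction Q a q = a • q := rfl

variable (Q) in
/-- The real endomorphisms of `Q` which normalize the action of `ℍ`: for `Q = ℍᵏ`, these are the
maps `q ↦ p q + q B`, and form the Lie algebra of `Sp(1)·GL(k, ℍ)`. -/
def quaternionicEnd : LieSubalgebra ℝ (Q →L[ℝ] Q) :=
  (quatAction Q).toLieHom.range.normalizer

lemma mem_quaternionicEnd {T : Q →L[ℝ] Q} :
    T ∈ quaternionicEnd Q ↔ ∀ a, ∃ n, quatAction Q n = ⁅T, quatAction Q a⁆ := by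
  rw [quaternionicEnd, LieSubalgebra.mem_normalizer_iff]
  exact ⟨fun h a => h _ ⟨a, rfl⟩, by rintro h _ ⟨a, rfl⟩; exact h a⟩

lemma isClosed_quaternionicEnd [FiniteDimensional ℝ Q] :
    IsClosed (quaternionicEnd Q : Set (Q →L[ℝ] Q)) :=
  (quaternionicEnd Q).toSubmodule.closed_of_finiteDimensional

lemma quatAction_mul_self {a : ℍ[ℝ]} (ha : a * a = -1) :
    quatAction Q a * quatAction Q a = -1 := by
  rw [← map_mul, ha, map_neg, map_one]

lemma exists_anticommute_eq_lie [Nontrivial Q] {T : Q →L[ℝ] Q} (hT : T ∈ quaternionicEnd Q)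
    {a : ℍ[ℝ]} (ha : a * a = -1) :
    ∃ n, n * a = -(a * n) ∧ quatAction Q n = ⁅T, quatAction Q a⁆ := by
  obtain ⟨n, hn⟩ := mem_quaternionicEnd.1 hT a
  refine ⟨n, (quatAction Q).toRingHom.injective ?_, hn⟩
  change quatAction Q (n * a) = quatAction Q (-(a * n))
  rw [map_neg, map_mul, map_mul, hn, Ring.lie_def, sub_mul, mul_sub, mul_assoc,
    quatAction_mul_self ha, ← mul_assoc, ← mul_assoc, quatAction_mul_self ha]
  noncomm_ring

lemma lie_complexify₂_eq_of_bianchi (hrank : 4 < Module.finrank ℝ Q) {K : Q → Q → Q →L[ℝ] Q}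
    (hK : ∀ u v, K u v ∈ quaternionicEnd Q) {a : ℍ[ℝ]} (ha : a * a = -1)
    (hbianchi : ∀ u v w,
      complexify₂ (fun (f : Q →L[ℝ] Q) (x : Q) => f x)
          (complexify₂ K (u, a • u) (v, a • v)) (w, a • w)
        + complexify₂ (fun (f : Q →L[ℝ] Q) (x : Q) => f x)
          (complexify₂ K (v, a • v) (w, a • w)) (u, a • u)
        + complexify₂ (fun (f : Q →L[ℝ] Q) (x : Q) => f x)
          (complexify₂ K (w, a • w) (u, a • u)) (v, a • v) = 0) (u v : Q) :
    quatAction Q a * ⁅(complexify₂ K (u, a • u) (v, a • v)).1, quatAction Q a⁆ =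
      ⁅(complexify₂ K (u, a • u) (v, a • v)).2, quatAction Q a⁆ := by
  have : Nontrivial Q := Module.nontrivial_of_finrank_pos (R := ℝ) (by omega)
  set r := fun u v => complexify₂ K (u, a • u) (v, a • v)
  have hr₁ : ∀ u v, (r u v).1 ∈ quaternionicEnd Q := fun u v => sub_mem (hK _ _) (hK _ _)
  have hr₂ : ∀ u v, (r u v).2 ∈ quaternionicEnd Q := fun u v => add_mem (hK _ _) (hK _ _)
  choose m hm hmr using fun u v => exists_anticommute_eq_lie (hr₁ u v) ha
  choose n hn hnr using fun u v => exists_anticommute_eq_lie (hr₂ u v) ha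
  -- `Im - J Re` vanishes on `ker (J + i)`, hence isolates the part of `r e₃` outside of it.
  have hcomp (u v w : Q) : (m u v + a * n u v) • w =
      (complexify₂ (fun (f : Q →L[ℝ] Q) (x : Q) => f x) (r u v) (w, a • w)).2
        - a • (complexify₂ (fun (f : Q →L[ℝ] Q) (x : Q) => f x) (r u v) (w, a • w)).1 := by
    rw [← quatAction_apply, map_add, map_mul, hmr, hnr, Ring.lie_def, Ring.lie_def]
    simp only [complexify₂, add_apply, sub_apply, mul_apply_eq_comp, quatAction_apply, smul_sub,
      smul_smul, ha, neg_smul, one_smul]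
    abel
  have hzero : m u v + a * n u v = 0 := by
    refine eq_zero_of_cyclic_sum_eq_zero hrank ha (m := fun u v => m u v + a * n u v)
      (fun u v => ?_) (fun u v w => ?_) u v
    · rw [add_mul, hm, mul_assoc, hn]; noncomm_ring
    · rw [hcomp, hcomp, hcomp]
      have h₁ := congrArg Prod.fst (hbianchi u v w)
      have h₂ := congrArg Prod.snd (hbianchi u v w)
      simp only [Prod.fst_add, Prod.snd_add, Prod.fst_zero, Prod.snd_zero] at h₁ h₂
      rw [← sub_eq_zero.2 (h₂.trans (smul_zero a).symm), ← h₁, smul_add, smul_add]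
      abel
  rw [← hmr, ← hnr, ← map_mul, eq_neg_of_add_eq_zero_left hzero, mul_neg, ← mul_assoc, ha,
    neg_one_mul, neg_neg]

end QuaternionicAlgebra

section Frame

variable {EM : Type*} [NormedAddCommGroup EM] [NormedSpace ℝ EM]
  {M : Type*} [TopologicalSpace M] [ChartedSpace EM M]
  {F : Type*} [NormedAddCommGroup F] [NormedSpace ℝ F]
  {V : M → Type*} [TopologicalSpace (TotalSpace F V)]
  [∀ x, AddCommGroup (V x)] [∀ x, Module ℝ (V x)] [∀ x, TopologicalSpace (V x)]
  [FiberBundle F V] [VectorBundle ℝ F V]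

section Coordinates

variable (e : Trivialization F (π F V)) [MemTrivializationAtlas e]

/-- The coordinates of a section in a trivialization. -/
def frameCoord (s : ∀ x, V x) (y : M) : F := e.linearMapAt ℝ y (s y)

variable {e}

lemma frameCoord_eventuallyEq {x : M} (hx : x ∈ e.baseSet) (s : ∀ x, V x) :
    frameCoord e s =ᶠ[𝓝 x] fun y => (e ⟨y, s y⟩).2 := by
  filter_upwards [e.open_baseSet.mem_nhds hx] with y hy
  rw [frameCoord, e.coe_linearMapAt_of_mem hy]

lemma frameCoord_symm_eventuallyEq {x : M} (hx : x ∈ e.baseSet) (q : F) :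
    frameCoord e (fun y => e.symmₗ ℝ y q) =ᶠ[𝓝 x] fun _ => q := by
  filter_upwards [e.open_baseSet.mem_nhds hx] with y hy
  rw [frameCoord, e.linearMapAt_symmₗ hy]

variable [ContMDiffVectorBundle ∞ F V 𝓘(ℝ, EM)]

lemma contMDiffVectorBundle_one : ContMDiffVectorBundle 1 F V 𝓘(ℝ, EM) :=
  .of_le (n := ∞) ENat.LEInfty.out

lemma contMDiffAt_frameCoord_iff {x : M} (hx : x ∈ e.baseSet) {s : ∀ x, V x} :
    ContMDiffAt 𝓘(ℝ, EM) 𝓘(ℝ, F) ∞ (frameCoord e s) x ↔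
      ContMDiffAt 𝓘(ℝ, EM) (𝓘(ℝ, EM).prod 𝓘(ℝ, F)) ∞ (T% s) x := by
  rw [e.contMDiffAt_section_iff hx]
  exact (frameCoord_eventuallyEq hx s).contMDiffAt_iff

lemma mdifferentiableAt_frameCoord_iff {x : M} (hx : x ∈ e.baseSet) {s : ∀ x, V x} :
    MDifferentiableAt 𝓘(ℝ, EM) 𝓘(ℝ, F) (frameCoord e s) x ↔
      MDifferentiableAt 𝓘(ℝ, EM) (𝓘(ℝ, EM).prod 𝓘(ℝ, F)) (T% s) x := by
  have : ContMDiffVectorBundle 1 F V 𝓘(ℝ, EM) := contMDiffVectorBundle_one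
  rw [e.mdifferentiableAt_section_iff _ _ hx]
  exact (frameCoord_eventuallyEq hx s).mdifferentiableAt_iff

lemma contMDiffOn_symm_const (q : F) :
    ContMDiffOn 𝓘(ℝ, EM) (𝓘(ℝ, EM).prod 𝓘(ℝ, F)) ∞
      (T% fun y => (e.symmₗ ℝ y q : V y)) e.baseSet := fun _ hx =>
  ((contMDiffAt_frameCoord_iff hx).1 (contMDiffAt_const.congr_of_eventuallyEq
    (frameCoord_symm_eventuallyEq hx q))).contMDiffWithinAt

lemma contMDiffAt_symm_const {x : M} (hx : x ∈ e.baseSet) (q : F) :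
    ContMDiffAt 𝓘(ℝ, EM) (𝓘(ℝ, EM).prod 𝓘(ℝ, F)) ∞ (T% fun y => (e.symmₗ ℝ y q : V y)) x :=
  (contMDiffOn_symm_const q).contMDiffAt (e.open_baseSet.mem_nhds hx)

lemma mdifferentiableAt_symm_const {x : M} (hx : x ∈ e.baseSet) (q : F) :
    MDifferentiableAt 𝓘(ℝ, EM) (𝓘(ℝ, EM).prod 𝓘(ℝ, F)) (T% fun y => (e.symmₗ ℝ y q : V y)) x :=
  (contMDiffAt_symm_const hx q).mdifferentiableAt (by simp)

end Coordinates

section Chart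

variable [IsManifold 𝓘(ℝ, EM) ∞ M] {x₀ x : M}

lemma mvfderiv_extChartAt_eq_linearMapAt (hx : x ∈ (chartAt EM x₀).source)
    (X : TangentSpace 𝓘(ℝ, EM) x) :
    mvfderiv 𝓘(ℝ, EM) (extChartAt 𝓘(ℝ, EM) x₀) x X =
      (trivializationAt EM (TangentSpace 𝓘(ℝ, EM) : M → Type _) x₀).linearMapAt ℝ x X :=
  (congrArg (fun L => L X)
    (TangentBundle.continuousLinearMapAt_trivializationAt (I := 𝓘(ℝ, EM)) hx)).symm

lemma symmₗ_mvfderiv_extChartAt (hx : x ∈ (chartAt EM x₀).source)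
    (X : TangentSpace 𝓘(ℝ, EM) x) :
    (trivializationAt EM (TangentSpace 𝓘(ℝ, EM) : M → Type _) x₀).symmₗ ℝ x
      (mvfderiv 𝓘(ℝ, EM) (extChartAt 𝓘(ℝ, EM) x₀) x X) = X := by
  rw [mvfderiv_extChartAt_eq_linearMapAt hx]
  exact Trivialization.symmₗ_linearMapAt _ hx X

lemma mvfderiv_extChartAt_injective (hx : x ∈ (chartAt EM x₀).source) :
    Function.Injective (mvfderiv 𝓘(ℝ, EM) (extChartAt 𝓘(ℝ, EM) x₀) x) :=
  Function.LeftInverse.injective (symmₗ_mvfderiv_extChartAt hx)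

end Chart

variable [∀ x, IsTopologicalAddGroup (V x)] [∀ x, ContinuousSMul ℝ (V x)]

/-- The flat connection of a trivialization. -/
def flatCov (e : Trivialization F (π F V)) [MemTrivializationAtlas e] (s : ∀ x, V x) (x : M) :
    TangentSpace 𝓘(ℝ, EM) x →L[ℝ] V x :=
  e.symmL ℝ x ∘L mvfderiv 𝓘(ℝ, EM) (frameCoord e s) x

variable [ContMDiffVectorBundle ∞ F V 𝓘(ℝ, EM)]

lemma isCovariantDerivativeOn_flatCov (e : Trivialization F (π F V)) [MemTrivializationAtlas e] :
    IsCovariantDerivativeOn (I := 𝓘(ℝ, EM)) F (flatCov (EM := EM) (V := V) e) e.baseSet where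
  add {s t x} hs ht hx := by
    have hcoord : frameCoord e (s + t) = frameCoord e s + frameCoord e t :=
      funext fun y => map_add (e.linearMapAt ℝ y) (s y) (t y)
    rw [flatCov, flatCov, flatCov, hcoord, mvfderiv_add
      ((mdifferentiableAt_frameCoord_iff hx).2 hs) ((mdifferentiableAt_frameCoord_iff hx).2 ht),
      ContinuousLinearMap.comp_add]
  leibniz {s g x} hs hg hx := by
    have hcoord : frameCoord e (g • s) = g • frameCoord e s :=
      funext fun y => map_smul (e.linearMapAt ℝ y) (g y) (s y)
    have hsx : e.symmL ℝ x (frameCoord e s x) = s x := e.symmₗ_linearMapAt hx (s x)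
    rw [flatCov, flatCov, hcoord, mvfderiv_smul hg ((mdifferentiableAt_frameCoord_iff hx).2 hs)]
    ext X
    simp only [ContinuousLinearMap.comp_apply, add_apply, smul_apply, map_add, map_smul,
      ContinuousLinearMap.smulRight_apply, hsx]

/-- The difference between a connection and the flat connection of a trivialization. -/
def connectionDiff [FiniteDimensional ℝ F] (nabla : CovariantDerivative 𝓘(ℝ, EM) F V)
    (e : Trivialization F (π F V)) [MemTrivializationAtlas e] (x : M) :
    V x →L[ℝ] TangentSpace 𝓘(ℝ, EM) x →L[ℝ] V x :=
  have : ContMDiffVectorBundle 1 F V 𝓘(ℝ, EM) := contMDiffVectorBundle_one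
  IsCovariantDerivativeOn.difference (nabla.isCovariantDerivativeOn (s := e.baseSet))
    (isCovariantDerivativeOn_flatCov (EM := EM) e) x

variable [IsManifold 𝓘(ℝ, EM) ∞ M] [FiniteDimensional ℝ EM]

/-- The connection form of `∇` in a trivialization `e` of `V` and in the coordinates of `M` at
`x₀`. It represents `∇` on the intersection of their domains. -/
def connectionForm [FiniteDimensional ℝ F] (nabla : CovariantDerivative 𝓘(ℝ, EM) F V)
    (e : Trivialization F (π F V)) [MemTrivializationAtlas e] (x₀ : M) :
    ConnectionForm M EM F where
  base := extChartAt 𝓘(ℝ, EM) x₀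
  form y := LinearMap.toContinuousLinearMap (LinearMap.toContinuousLinearMap.toLinearMap ∘ₗ
    LinearMap.mk₂ ℝ (fun b q => e.linearMapAt ℝ y (connectionDiff nabla e y (e.symmₗ ℝ y q)
      ((trivializationAt EM (TangentSpace 𝓘(ℝ, EM) : M → Type _) x₀).symmₗ ℝ y b)))
      (by simp) (by simp) (by simp) (by simp))

variable [FiniteDimensional ℝ F] {nabla : CovariantDerivative 𝓘(ℝ, EM) F V}
  {e : Trivialization F (π F V)} [MemTrivializationAtlas e] {x₀ x : M}

lemma linearMapAt_nabla (hx : x ∈ e.baseSet) (hx₀ : x ∈ (chartAt EM x₀).source) {s : ∀ x, V x}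
    (hs : MDiffAt (T% s) x) (X : TangentSpace 𝓘(ℝ, EM) x) :
    e.linearMapAt ℝ x (nabla s x X) =
      (connectionForm nabla e x₀).covDeriv 𝓘(ℝ, EM) (frameCoord e s) x X := by
  have : ContMDiffVectorBundle 1 F V 𝓘(ℝ, EM) := contMDiffVectorBundle_one
  have hdiff : connectionDiff nabla e x (s x) = nabla s x - flatCov e s x :=
    IsCovariantDerivativeOn.difference_apply (nabla.isCovariantDerivativeOn (s := e.baseSet))
      (isCovariantDerivativeOn_flatCov (EM := EM) e) hx hs
  have hflat : e.linearMapAt ℝ x (flatCov e s x X) = mvfderiv 𝓘(ℝ, EM) (frameCoord e s) x X :=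
    e.linearMapAt_symmₗ hx _
  have hform : (connectionForm nabla e x₀).oneForm 𝓘(ℝ, EM) x X (frameCoord e s x) =
      e.linearMapAt ℝ x (connectionDiff nabla e x (s x) X) := by
    change e.linearMapAt ℝ x (connectionDiff nabla e x (e.symmₗ ℝ x (e.linearMapAt ℝ x (s x)))
      (Trivialization.symmₗ ℝ _ x (mvfderiv 𝓘(ℝ, EM) (extChartAt 𝓘(ℝ, EM) x₀) x X))) = _
    rw [symmₗ_mvfderiv_extChartAt hx₀, e.symmₗ_linearMapAt hx]
  rw [ConnectionForm.covDeriv, hform, hdiff, sub_apply, map_sub, hflat, add_sub_cancel]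

lemma oneForm_connectionForm (hx : x ∈ e.baseSet) (hx₀ : x ∈ (chartAt EM x₀).source)
    (X : TangentSpace 𝓘(ℝ, EM) x) (q : F) :
    (connectionForm nabla e x₀).oneForm 𝓘(ℝ, EM) x X q =
      e.linearMapAt ℝ x (nabla (fun y => e.symmₗ ℝ y q) x X) := by
  rw [linearMapAt_nabla hx hx₀ (mdifferentiableAt_symm_const hx q),
    ConnectionForm.covDeriv_congr (frameCoord_symm_eventuallyEq hx q), ConnectionForm.covDeriv,
    mvfderiv_const, zero_apply, zero_add]

lemma form_connectionForm (hx : x ∈ e.baseSet) (hx₀ : x ∈ (chartAt EM x₀).source) (b : EM)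
    (q : F) :
    (connectionForm nabla e x₀).form x b q =
      e.linearMapAt ℝ x (nabla (fun y => e.symmₗ ℝ y q) x
        ((trivializationAt EM (TangentSpace 𝓘(ℝ, EM) : M → Type _) x₀).symmₗ ℝ x b)) := by
  rw [← oneForm_connectionForm hx hx₀, ConnectionForm.oneForm]
  have := mvfderiv_extChartAt_eq_linearMapAt hx₀
    ((trivializationAt EM (TangentSpace 𝓘(ℝ, EM) : M → Type _) x₀).symmₗ ℝ x b)
  rw [Trivialization.linearMapAt_symmₗ _ hx₀] at this
  exact congrArg (fun b => (connectionForm nabla e x₀).form x b q) this.symm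

omit [FiniteDimensional ℝ F] in
/-- A smooth connection is only assumed to preserve the smoothness of global sections, whence the
cutoff. -/
lemma mdifferentiableAt_nabla_apply [T2Space M] [nabla.ContMDiffCovariantDerivative ∞]
    {U : Set M} (hU : IsOpen U) (hx : x ∈ U) {s : ∀ x, V x}
    (hs : ContMDiffOn 𝓘(ℝ, EM) (𝓘(ℝ, EM).prod 𝓘(ℝ, F)) ∞ (T% s) U)
    {Y : ∀ x : M, TangentSpace 𝓘(ℝ, EM) x} (hY : MDiffAt (T% Y) x) :
    MDifferentiableAt 𝓘(ℝ, EM) (𝓘(ℝ, EM).prod 𝓘(ℝ, F)) (T% fun y => nabla s y (Y y)) x := by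
  have : ContMDiffVectorBundle 1 F V 𝓘(ℝ, EM) := contMDiffVectorBundle_one
  obtain ⟨ψ, hψ⟩ := ((SmoothBumpFunction.nhds_basis_tsupport (I := 𝓘(ℝ, EM)) x).mem_iff).1
    (hU.mem_nhds hx)
  have hψs : ContMDiff 𝓘(ℝ, EM) (𝓘(ℝ, EM).prod 𝓘(ℝ, F)) ∞ (T% ((ψ : M → ℝ) • s)) :=
    ContMDiffOn.smul_section_of_tsupport ψ.contMDiff.contMDiffOn hU hψ.2 hs
  have hnabla := (CovariantDerivative.ContMDiffCovariantDerivative.contMDiff (cov := nabla)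
    (k := ∞)).contMDiff hψs.contMDiffOn
  refine (((hnabla.contMDiffAt Filter.univ_mem).mdifferentiableAt
    (by simp)).clm_bundle_apply hY).congr_of_eventuallyEq ?_
  filter_upwards [ψ.eventuallyEq_one.eventuallyEq_nhds, hU.mem_nhds hx] with y hy hyU
  rw [nabla.isCovariantDerivativeOnUniv.congr_of_eventuallyEq
    (((hs y hyU).contMDiffAt (hU.mem_nhds hyU)).mdifferentiableAt (by simp))
    (hψs.contMDiffAt.mdifferentiableAt (by simp)) Filter.univ_mem
    (hy.mono fun w hw => by simp [hw])]

lemma isRegularAt_connectionForm [T2Space M] [nabla.ContMDiffCovariantDerivative ∞]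
    (hx₀ : x₀ ∈ e.baseSet) : (connectionForm nabla e x₀).IsRegularAt 𝓘(ℝ, EM) x₀ where
  base := contMDiffAt_extChartAt
  form := by
    refine mdifferentiableAt_toContinuousLinearMap fun b =>
      mdifferentiableAt_toContinuousLinearMap fun q => ?_
    have hcoord := (mdifferentiableAt_frameCoord_iff hx₀).2 (mdifferentiableAt_nabla_apply
      (nabla := nabla) e.open_baseSet hx₀ (contMDiffOn_symm_const q)
      (mdifferentiableAt_symm_const (FiberBundle.mem_baseSet_trivializationAt' x₀) b))
    refine hcoord.congr_of_eventuallyEq ?_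
    filter_upwards [e.open_baseSet.mem_nhds hx₀, chart_source_mem_nhds EM x₀] with y hy hy₀
    exact form_connectionForm hy hy₀ b q

end Frame

section CoCRFrame

variable {EM : Type*} [NormedAddCommGroup EM] [NormedSpace ℝ EM]
  {M : Type*} [TopologicalSpace M] [ChartedSpace EM M] [IsManifold 𝓘(ℝ, EM) ∞ M]
  {k : ℕ} {V : M → Type*} [TopologicalSpace (TotalSpace (QSpace k) V)]
  [∀ x, AddCommGroup (V x)] [∀ x, Module ℝ (V x)] [∀ x, TopologicalSpace (V x)]
  [FiberBundle (QSpace k) V] [VectorBundle ℝ (QSpace k) V]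
  {ρ : ∀ x : M, V x →ₗ[ℝ] TangentSpace 𝓘(ℝ, EM) x}
  {e : Trivialization (QSpace k) (π (QSpace k) V)} [MemTrivializationAtlas e] {x x₀ : M}

variable (ρ e x₀) in
/-- The anchor `ρ` in a trivialization `e` of `V` and in the coordinates of `M` at `x₀`. -/
def anchorForm (y : M) : QSpace k →L[ℝ] EM :=
  LinearMap.toContinuousLinearMap
    ((mvfderiv 𝓘(ℝ, EM) (extChartAt 𝓘(ℝ, EM) x₀) y).toLinearMap ∘ₗ ρ y ∘ₗ e.symmₗ ℝ y)

lemma mvfderiv_extChartAt_eq_anchorForm_iff (hx₀ : x ∈ (chartAt EM x₀).source)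
    (X : TangentSpace 𝓘(ℝ, EM) x) (q : QSpace k) :
    mvfderiv 𝓘(ℝ, EM) (extChartAt 𝓘(ℝ, EM) x₀) x X = anchorForm ρ e x₀ x q ↔
      X = ρ x (e.symmₗ ℝ x q) :=
  (mvfderiv_extChartAt_injective hx₀).eq_iff

variable [ContMDiffVectorBundle ∞ (QSpace k) V 𝓘(ℝ, EM)]

lemma mdifferentiableAt_anchor
    (hρ : ContMDiff (𝓘(ℝ, EM).prod 𝓘(ℝ, QSpace k)) (𝓘(ℝ, EM).prod 𝓘(ℝ, EM)) ∞
      fun v : TotalSpace (QSpace k) V => (⟨v.1, ρ v.1 v.2⟩ : TangentBundle 𝓘(ℝ, EM) M))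
    (hx : x ∈ e.baseSet) (q : QSpace k) :
    MDiffAt (T% fun y => ρ y (e.symmₗ ℝ y q)) x :=
  (hρ.contMDiffAt.comp x (contMDiffAt_symm_const hx q)).mdifferentiableAt (by simp)

variable [FiniteDimensional ℝ EM]

lemma mdifferentiableAt_anchorForm
    (hρ : ContMDiff (𝓘(ℝ, EM).prod 𝓘(ℝ, QSpace k)) (𝓘(ℝ, EM).prod 𝓘(ℝ, EM)) ∞
      fun v : TotalSpace (QSpace k) V => (⟨v.1, ρ v.1 v.2⟩ : TangentBundle 𝓘(ℝ, EM) M))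
    (hx₀ : x₀ ∈ e.baseSet) :
    MDifferentiableAt 𝓘(ℝ, EM) 𝓘(ℝ, QSpace k →L[ℝ] EM) (anchorForm ρ e x₀) x₀ :=
  mdifferentiableAt_toContinuousLinearMap fun q =>
    mdifferentiableAt_mvfderiv_apply contMDiffAt_extChartAt (mdifferentiableAt_anchor hρ hx₀ q)

variable [∀ x, IsTopologicalAddGroup (V x)] [∀ x, ContinuousSMul ℝ (V x)]
  {nabla : CovariantDerivative 𝓘(ℝ, EM) (QSpace k) V}

lemma IsTorsionFree.isTorsionFreeAt (h : IsTorsionFree nabla ρ)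
    (hρ : ContMDiff (𝓘(ℝ, EM).prod 𝓘(ℝ, QSpace k)) (𝓘(ℝ, EM).prod 𝓘(ℝ, EM)) ∞
      fun v : TotalSpace (QSpace k) V => (⟨v.1, ρ v.1 v.2⟩ : TangentBundle 𝓘(ℝ, EM) M))
    (hx₀ : x₀ ∈ e.baseSet) :
    IsTorsionFreeAt 𝓘(ℝ, EM) (connectionForm nabla e x₀) (anchorForm ρ e x₀) x₀ := by
  intro ξ η p q hξ hη
  have hchart := mem_chart_source EM x₀
  obtain rfl := (mvfderiv_extChartAt_eq_anchorForm_iff hchart ξ p).1 hξ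
  obtain rfl := (mvfderiv_extChartAt_eq_anchorForm_iff hchart η q).1 hη
  have hderiv (X : TangentSpace 𝓘(ℝ, EM) x₀) (q : QSpace k) :
      mvfderiv 𝓘(ℝ, EM) (anchorForm ρ e x₀) x₀ X q =
        mvfderiv 𝓘(ℝ, EM) (fun y => mvfderiv 𝓘(ℝ, EM) (extChartAt 𝓘(ℝ, EM) x₀) y
          (ρ y (e.symmₗ ℝ y q))) x₀ X := by
    have h := mvfderiv_clm_apply (mdifferentiableAt_anchorForm hρ hx₀)
      (mdifferentiableAt_const (c := q)) X
    rw [mvfderiv_const, zero_apply, map_zero, add_zero] at h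
    exact h.symm
  have htorsion := sub_eq_zero.1 (h e.baseSet (fun y => e.symmₗ ℝ y p) (fun y => e.symmₗ ℝ y q)
    e.open_baseSet (contMDiffOn_symm_const p) (contMDiffOn_symm_const q) x₀ hx₀)
  rw [hderiv, hderiv, ← mvfderiv_apply_mlieBracket contMDiffAt_extChartAt
    (mdifferentiableAt_anchor hρ hx₀ p) (mdifferentiableAt_anchor hρ hx₀ q), ← htorsion,
    oneForm_connectionForm hx₀ hchart, oneForm_connectionForm hx₀ hchart, ← map_sub]
  exact congrArg (fun v => mvfderiv 𝓘(ℝ, EM) (extChartAt 𝓘(ℝ, EM) x₀) x₀ (ρ x₀ v))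
    (e.symmₗ_linearMapAt hx₀ _)

lemma linearMapAt_curvatureOfFields [T2Space M] [nabla.ContMDiffCovariantDerivative ∞]
    (hx₀ : x₀ ∈ e.baseSet) {U : Set M} (hU : IsOpen U) (hx₀U : x₀ ∈ U) {s : ∀ x, V x}
    (hs : IsSmoothSectionOn EM k s U) {X Y : ∀ x : M, TangentSpace 𝓘(ℝ, EM) x}
    (hX : MDiffAt (T% X) x₀) (hY : MDiffAt (T% Y) x₀) :
    e.linearMapAt ℝ x₀ (curvatureOfFields nabla X Y s x₀) =
      (connectionForm nabla e x₀).curv 𝓘(ℝ, EM) x₀ (X x₀) (Y x₀) (frameCoord e s x₀) := by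
  have hchart := mem_chart_source EM x₀
  have hs' : ∀ y ∈ U, ContMDiffAt 𝓘(ℝ, EM) (𝓘(ℝ, EM).prod 𝓘(ℝ, QSpace k)) ∞ (T% s) y :=
    fun y hy => hs.contMDiffAt (hU.mem_nhds hy)
  have hcoord : ∀ Z : ∀ x : M, TangentSpace 𝓘(ℝ, EM) x,
      frameCoord e (fun y => nabla s y (Z y)) =ᶠ[𝓝 x₀]
        fun y => (connectionForm nabla e x₀).covDeriv 𝓘(ℝ, EM) (frameCoord e s) y (Z y) := by
    intro Z
    filter_upwards [hU.mem_nhds hx₀U, e.open_baseSet.mem_nhds hx₀,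
      chart_source_mem_nhds EM x₀] with y hyU hye hy
    exact linearMapAt_nabla hye hy ((hs' y hyU).mdifferentiableAt (by simp)) _
  rw [curvatureOfFields, map_sub, map_sub,
    linearMapAt_nabla hx₀ hchart (mdifferentiableAt_nabla_apply hU hx₀U hs hY),
    linearMapAt_nabla hx₀ hchart (mdifferentiableAt_nabla_apply hU hx₀U hs hX),
    linearMapAt_nabla hx₀ hchart ((hs' x₀ hx₀U).mdifferentiableAt (by simp)),
    ConnectionForm.covDeriv_congr (hcoord Y), ConnectionForm.covDeriv_congr (hcoord X)]
  exact (isRegularAt_connectionForm hx₀).commutator_covDeriv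
    (((contMDiffAt_frameCoord_iff hx₀).2 (hs' x₀ hx₀U)).of_le ENat.LEInfty.out) hX hY

lemma linearMapAt_curvature [T2Space M] [nabla.ContMDiffCovariantDerivative ∞]
    (hx₀ : x₀ ∈ e.baseSet) (X Y : TangentSpace 𝓘(ℝ, EM) x₀) (v : V x₀) :
    e.linearMapAt ℝ x₀ (curvature nabla x₀ X Y v) =
      (connectionForm nabla e x₀).curv 𝓘(ℝ, EM) x₀ X Y (e.linearMapAt ℝ x₀ v) := by
  obtain ⟨U, hU, hs⟩ := FiberBundle.exists_contMDiffOn_extend 𝓘(ℝ, EM) (QSpace k) (k := ∞) v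
  obtain ⟨U', hU', hUo, hxU⟩ := mem_nhds_iff.1 hU
  have hextend (X : TangentSpace 𝓘(ℝ, EM) x₀) : MDiffAt (T% (FiberBundle.extend EM X)) x₀ :=
    (FiberBundle.contMDiffAt_extend 𝓘(ℝ, EM) EM (k := ∞) X).mdifferentiableAt (by simp)
  have h := linearMapAt_curvatureOfFields (nabla := nabla) hx₀ hUo hxU (hs.mono hU')
    (hextend X) (hextend Y)
  simpa only [curvature, frameCoord, FiberBundle.extend_apply_self] using h

lemma smul_add_vecMul_mem_quaternionicEnd {T : QSpace k →L[ℝ] QSpace k} {p : ℍ[ℝ]}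
    {B : Matrix (Fin k) (Fin k) ℍ[ℝ]} (hT : ∀ q, T q = p • q + Matrix.vecMul q B) :
    T ∈ quaternionicEnd (QSpace k) := by
  refine mem_quaternionicEnd.2 fun a => ⟨p * a - a * p, ?_⟩
  ext1 q
  change (p * a - a * p) • q = T (a • q) - a • T q
  rw [hT, hT, Matrix.smul_vecMul, smul_add, sub_smul, mul_smul, mul_smul]
  abel

lemma IsCompatible.form_mem_quaternionicEnd (h : IsCompatible nabla) (hx : x ∈ e.baseSet)
    (hx₀ : x ∈ (chartAt EM x₀).source) (b : EM) :
    (connectionForm nabla e x₀).form x b ∈ quaternionicEnd (QSpace k) := by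
  obtain ⟨p, B, hpB⟩ := h e x hx
    ((trivializationAt EM (TangentSpace 𝓘(ℝ, EM) : M → Type _) x₀).symmₗ ℝ x b)
  exact smul_add_vecMul_mem_quaternionicEnd fun q => (form_connectionForm hx hx₀ b q).trans (hpB q)

lemma IsCompatible.curv_mem_quaternionicEnd [T2Space M] [nabla.ContMDiffCovariantDerivative ∞]
    (h : IsCompatible nabla) (hx₀ : x₀ ∈ e.baseSet) (X Y : TangentSpace 𝓘(ℝ, EM) x₀) :
    (connectionForm nabla e x₀).curv 𝓘(ℝ, EM) x₀ X Y ∈ quaternionicEnd (QSpace k) := by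
  refine ConnectionForm.curv_mem isClosed_quaternionicEnd (isRegularAt_connectionForm hx₀) ?_ X Y
  filter_upwards [e.open_baseSet.mem_nhds hx₀, chart_source_mem_nhds EM x₀] with y hy hy₀ b
  exact h.form_mem_quaternionicEnd hy hy₀ b

end CoCRFrame

section TwistorSphere

instance fact_finrank_euclideanSpace_three :
    Fact (Module.finrank ℝ (EuclideanSpace ℝ (Fin 3)) = 2 + 1) :=
  ⟨finrank_euclideanSpace_fin⟩

@[simp] lemma imQ_re (v : EuclideanSpace ℝ (Fin 3)) : (imQ v).re = 0 := rfl

@[simp] lemma imQ_imI (v : EuclideanSpace ℝ (Fin 3)) : (imQ v).imI = v 0 := rfl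

@[simp] lemma imQ_imJ (v : EuclideanSpace ℝ (Fin 3)) : (imQ v).imJ = v 1 := rfl

@[simp] lemma imQ_imK (v : EuclideanSpace ℝ (Fin 3)) : (imQ v).imK = v 2 := rfl

/-- The linear map `imQ`, as a continuous linear map. -/
def imQL : EuclideanSpace ℝ (Fin 3) →L[ℝ] ℍ[ℝ] :=
  LinearMap.toContinuousLinearMap
    { toFun := imQ
      map_add' := fun v w => by ext <;> simp
      map_smul' := fun c v => by ext <;> simp }

lemma sum_sq_eq_one (a : S2) : a.1 0 ^ 2 + a.1 1 ^ 2 + a.1 2 ^ 2 = 1 := by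
  rw [← Fin.sum_univ_three (fun i => a.1 i ^ 2), ← EuclideanSpace.real_norm_sq_eq,
    norm_eq_of_mem_sphere, one_pow]

lemma imQ_mul_self (a : S2) : imQ a * imQ a = -1 := by
  have h := sum_sq_eq_one a
  ext <;> simp only [re_mul, imI_mul, imJ_mul, imK_mul, imQ_re, imQ_imI, imQ_imJ, imQ_imK, re_neg,
    imI_neg, imJ_neg, imK_neg, re_one, imI_one, imJ_one, imK_one] <;> linarith

lemma exists_imQ_eq_of_anticommute (a : S2) {n : ℍ[ℝ]} (hn : n * imQ a = -(imQ a * n)) :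
    ∃ v ∈ (Submodule.span ℝ {(a : EuclideanSpace ℝ (Fin 3))})ᗮ, imQ v = n := by
  have hre := congrArg QuaternionAlgebra.re hn
  have hI := congrArg QuaternionAlgebra.imI hn
  have hJ := congrArg QuaternionAlgebra.imJ hn
  have hK := congrArg QuaternionAlgebra.imK hn
  simp only [re_mul, imI_mul, imJ_mul, imK_mul, re_neg, imI_neg, imJ_neg, imK_neg, imQ_re,
    imQ_imI, imQ_imJ, imQ_imK] at hre hI hJ hK
  refine ⟨!₂[n.imI, n.imJ, n.imK], ?_, ?_⟩
  · rw [Submodule.mem_orthogonal_singleton_iff_inner_right]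
    simp only [PiLp.inner_apply, RCLike.inner_apply, Real.ringHom_apply, Fin.sum_univ_three,
      Matrix.cons_val_zero, Matrix.cons_val_one, Matrix.cons_val]
    linarith
  · have hn_re : n.re = 0 := by
      linear_combination (-n.re) * sum_sq_eq_one a + (a.1 0 / 2) * hI + (a.1 1 / 2) * hJ
        + (a.1 2 / 2) * hK
    ext <;> simp [hn_re]

variable {EM : Type*} [NormedAddCommGroup EM] [NormedSpace ℝ EM]
  {M : Type*} [TopologicalSpace M] [ChartedSpace EM M]

variable (EM M) in
lemma contMDiff_snd_val : ContMDiff (𝓘(ℝ, EM).prod (𝓡 2)) 𝓘(ℝ, EuclideanSpace ℝ (Fin 3)) ∞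
    fun z : M × S2 => (z.2 : EuclideanSpace ℝ (Fin 3)) :=
  (contMDiff_coe_sphere (E := EuclideanSpace ℝ (Fin 3)) (n := 2)).comp contMDiff_snd

lemma mvfderiv_clm_imQ {G : Type*} [NormedAddCommGroup G] [NormedSpace ℝ G] (L : ℍ[ℝ] →L[ℝ] G)
    (z : M × S2) (ξ : TZ (EM := EM) z) :
    mvfderiv (𝓘(ℝ, EM).prod (𝓡 2)) (fun z : M × S2 => L (imQ z.2)) z ξ = L (dS z ξ) :=
  mvfderiv_clm_comp (L ∘L imQL) (f := fun z : M × S2 => (z.2 : EuclideanSpace ℝ (Fin 3)))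
    ((contMDiff_snd_val EM M).mdifferentiableAt (by simp)) ξ

/-- Differentiating `a ^ 2 = -1`. -/
lemma dS_mul_imQ (z : M × S2) (ξ : TZ (EM := EM) z) :
    dS z ξ * imQ z.2 = -(imQ z.2 * dS z ξ) := by
  have hA : MDifferentiableAt (𝓘(ℝ, EM).prod (𝓡 2)) 𝓘(ℝ, ℍ[ℝ]) (fun z : M × S2 => imQ z.2) z :=
    mdifferentiableAt_clm_comp imQL ((contMDiff_snd_val EM M).mdifferentiableAt (by simp))
  have h := mvfderiv_bilin (ContinuousLinearMap.mul ℝ ℍ[ℝ]) hA hA ξ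
  have hd := mvfderiv_clm_imQ (.id ℝ ℍ[ℝ]) z ξ
  simp only [ContinuousLinearMap.mul_apply', imQ_mul_self, mvfderiv_const] at h
  simp only [ContinuousLinearMap.id_apply] at hd
  rw [hd] at h
  exact eq_neg_of_add_eq_zero_left h.symm

lemma exists_vertical (z : M × S2) {n : ℍ[ℝ]} (hn : n * imQ z.2 = -(imQ z.2 * n)) :
    ∃ ξ : TZ (EM := EM) z, dπ z ξ = 0 ∧ dS z ξ = n := by
  obtain ⟨v, hv, rfl⟩ := exists_imQ_eq_of_anticommute z.2 hn
  rw [← range_mvfderiv_subtypeVal (n := 2)] at hv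
  obtain ⟨τ, rfl⟩ := hv
  refine ⟨(0, τ), ?_, ?_⟩
  · exact congrArg (fun L => L ((0, τ) : TZ (EM := EM) z))
      (mfderiv_fst (I := 𝓘(ℝ, EM)) (I' := 𝓡 2) (x := z))
  · have hcomp := mvfderiv_comp_mfderiv (I := 𝓡 2) (I' := 𝓘(ℝ, EM).prod (𝓡 2))
      (f := fun a : S2 => (a : EuclideanSpace ℝ (Fin 3))) (g := (Prod.snd : M × S2 → S2)) (w := z)
      ((contMDiff_coe_sphere (n := 2) (m := ∞)).mdifferentiableAt (by simp))
      mdifferentiableAt_snd (0, τ)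
    rw [mfderiv_snd] at hcomp
    exact congrArg imQ hcomp

end TwistorSphere

section TwistorSpace

lemma mem_kerAddI_iff {W : Type*} [AddCommGroup W] [Module ℝ W] {J : W →ₗ[ℝ] W}
    (hJ : ∀ w, J (J w) = -w) {w : W × W} : w ∈ kerAddI J ↔ w.2 = J w.1 := by
  refine ⟨fun h => (sub_eq_zero.1 h.1).symm, fun h => ⟨by rw [h, sub_self], ?_⟩⟩
  rw [h, hJ, neg_add_cancel]

/-- The tautological field of complex structures on the twistor space: in a trivialization, the
point `(x, a)` is the left multiplication by `a`. -/
def tautJ {M : Type*} (k : ℕ) (z : M × S2) : QSpace k →L[ℝ] QSpace k :=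
  quatAction (QSpace k) (imQ z.2)

lemma tautJ_mul_self {M : Type*} {k : ℕ} (z : M × S2) : tautJ k z * tautJ k z = -1 :=
  quatAction_mul_self (imQ_mul_self z.2)

variable {EM : Type*} [NormedAddCommGroup EM] [NormedSpace ℝ EM]
  {M : Type*} [TopologicalSpace M] [ChartedSpace EM M]
  {k : ℕ} {V : M → Type*} [TopologicalSpace (TotalSpace (QSpace k) V)]
  [∀ x, AddCommGroup (V x)] [∀ x, Module ℝ (V x)] [∀ x, TopologicalSpace (V x)]
  [FiberBundle (QSpace k) V] [VectorBundle ℝ (QSpace k) V]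
  {ρ : ∀ x : M, V x →ₗ[ℝ] TangentSpace 𝓘(ℝ, EM) x}
  {e : Trivialization (QSpace k) (π (QSpace k) V)} [MemTrivializationAtlas e]
  {x x₀ : M} {z : M × S2}

lemma trivJ_symmₗ (hx : x ∈ e.baseSet) (a : S2) (q : QSpace k) :
    trivJ e x a (e.symmₗ ℝ x q) = e.symmₗ ℝ x (imQ a • q) := by
  rw [trivJ, LinearMap.comp_apply, LinearMap.comp_apply, e.linearMapAt_symmₗ hx]
  rfl

lemma trivJ_trivJ (hx : x ∈ e.baseSet) (a : S2) (v : V x) :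
    trivJ e x a (trivJ e x a v) = -v := by
  rw [← e.symmₗ_linearMapAt (R := ℝ) hx v, trivJ_symmₗ hx, trivJ_symmₗ hx, smul_smul,
    imQ_mul_self, neg_smul, one_smul, map_neg]

lemma mem_kerAddI_trivJ_iff (hx : x ∈ e.baseSet) (a : S2) (w : V x × V x) :
    w ∈ kerAddI (trivJ e x a) ↔
      ∃ u : QSpace k, w.1 = e.symmₗ ℝ x u ∧ w.2 = e.symmₗ ℝ x (imQ a • u) := by
  rw [mem_kerAddI_iff (trivJ_trivJ hx a)]
  constructor
  · intro h
    refine ⟨e.linearMapAt ℝ x w.1, (e.symmₗ_linearMapAt hx _).symm, ?_⟩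
    rw [← trivJ_symmₗ hx, e.symmₗ_linearMapAt hx, h]
  · rintro ⟨u, h₁, h₂⟩
    rw [h₁, h₂, trivJ_symmₗ hx]

lemma eq_zero_of_mem_ker_anchor (hx : x ∈ e.baseSet) (a : S2)
    (hker : ∀ J ∈ admissible k V x, ∀ W : Submodule ℝ (V x),
      W ≤ LinearMap.ker (ρ x) → (∀ w ∈ W, J w ∈ W) → W = ⊥)
    {q : QSpace k} (h₁ : ρ x (e.symmₗ ℝ x q) = 0) (h₂ : ρ x (e.symmₗ ℝ x (imQ a • q)) = 0) :
    q = 0 := by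
  have hmem : e.symmₗ ℝ x q ∈ LinearMap.ker (ρ x) ⊓ LinearMap.ker (ρ x ∘ₗ trivJ e x a) :=
    ⟨h₁, (congrArg (ρ x) (trivJ_symmₗ hx a q)).trans h₂⟩
  rw [hker (trivJ e x a) ⟨e, inferInstance, hx, a, rfl⟩ _ inf_le_left ?_, Submodule.mem_bot]
    at hmem
  · rw [← e.linearMapAt_symmₗ (R := ℝ) hx q, hmem, map_zero]
  · rintro w ⟨hw, hJw⟩
    refine ⟨hJw, (congrArg (ρ x) (trivJ_trivJ hx a w)).trans ?_⟩
    rw [map_neg, LinearMap.mem_ker.1 hw, neg_zero]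

variable (EM) in
lemma contMDiffAt_tautJ (z : M × S2) :
    ContMDiffAt (𝓘(ℝ, EM).prod (𝓡 2)) 𝓘(ℝ, QSpace k →L[ℝ] QSpace k) 2 (tautJ k) z :=
  (((quatAction (QSpace k)).toLinearMap.toContinuousLinearMap ∘L imQL).contDiff.contMDiff.comp
    (contMDiff_snd_val EM M)).contMDiffAt.of_le ENat.LEInfty.out

lemma mvfderiv_tautJ (ξ : TZ (EM := EM) z) :
    mvfderiv (𝓘(ℝ, EM).prod (𝓡 2)) (tautJ k) z ξ = quatAction (QSpace k) (dS z ξ) :=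
  mvfderiv_clm_imQ (quatAction (QSpace k)).toLinearMap.toContinuousLinearMap z ξ

lemma IsTorsionFreeAt.pullback_fst {A : ConnectionForm M EM (QSpace k)}
    {R : M → QSpace k →L[ℝ] EM} (h : IsTorsionFreeAt 𝓘(ℝ, EM) A R z.1)
    (hA : MDiffAt A.base z.1) (hR : MDiffAt R z.1) :
    IsTorsionFreeAt (𝓘(ℝ, EM).prod (𝓡 2)) (A.pullback Prod.fst) (R ∘ Prod.fst) z := by
  intro ξ η p q hξ hη
  have hfst : MDifferentiableAt (𝓘(ℝ, EM).prod (𝓡 2)) 𝓘(ℝ, EM) (Prod.fst : M × S2 → M) z :=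
    mdifferentiableAt_fst
  rw [ConnectionForm.pullback, mvfderiv_comp_mfderiv hA hfst] at hξ hη
  rw [ConnectionForm.oneForm_pullback hA hfst, ConnectionForm.oneForm_pullback hA hfst,
    mvfderiv_comp_mfderiv hR hfst, mvfderiv_comp_mfderiv hR hfst]
  exact h _ _ _ _ hξ hη

variable [∀ x, IsTopologicalAddGroup (V x)] [∀ x, ContinuousSMul ℝ (V x)]
  {nabla : CovariantDerivative 𝓘(ℝ, EM) (QSpace k) V} [IsManifold 𝓘(ℝ, EM) ∞ M]
  [ContMDiffVectorBundle ∞ (QSpace k) V 𝓘(ℝ, EM)] [FiniteDimensional ℝ EM]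

/-- The connection form of `∇`, pulled back to the twistor space. -/
def twistorForm (nabla : CovariantDerivative 𝓘(ℝ, EM) (QSpace k) V)
    (e : Trivialization (QSpace k) (π (QSpace k) V)) [MemTrivializationAtlas e] (x₀ : M) :
    ConnectionForm (M × S2) EM (QSpace k) :=
  (connectionForm nabla e x₀).pullback Prod.fst

lemma mdifferentiableAt_base_connectionForm (hx₀ : x ∈ (chartAt EM x₀).source) :
    MDiffAt (connectionForm nabla e x₀).base x :=
  mdifferentiableAt_extChartAt hx₀

lemma mvfderiv_base_twistorForm_eq_anchorForm_iff (hz₀ : z.1 ∈ (chartAt EM x₀).source)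
    (ξ : TZ (EM := EM) z) (q : QSpace k) :
    mvfderiv (𝓘(ℝ, EM).prod (𝓡 2)) (twistorForm nabla e x₀).base z ξ = anchorForm ρ e x₀ z.1 q ↔
      dπ z ξ = ρ z.1 (e.symmₗ ℝ z.1 q) := by
  rw [← mvfderiv_extChartAt_eq_anchorForm_iff hz₀]
  exact Eq.congr_left (mvfderiv_comp_mfderiv
    (mdifferentiableAt_base_connectionForm (nabla := nabla) (e := e) hz₀) mdifferentiableAt_fst ξ)

lemma covDeriv_tautJ (hz₀ : z.1 ∈ (chartAt EM x₀).source) (ξ : TZ (EM := EM) z) :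
    (twistorForm nabla e x₀).ad.covDeriv (𝓘(ℝ, EM).prod (𝓡 2)) (tautJ k) z ξ =
      quatAction (QSpace k) (dS z ξ)
        + ⁅(connectionForm nabla e x₀).oneForm 𝓘(ℝ, EM) z.1 (dπ z ξ), tautJ k z⁆ := by
  rw [ConnectionForm.covDeriv, mvfderiv_tautJ, ConnectionForm.oneForm_ad, twistorForm,
    ConnectionForm.oneForm_pullback (mdifferentiableAt_base_connectionForm hz₀)
      mdifferentiableAt_fst]
  rfl

lemma covDeriv_tautJ_of_dπ_eq_zero (hz₀ : z.1 ∈ (chartAt EM x₀).source) {ξ : TZ (EM := EM) z}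
    (hξ : dπ z ξ = 0) :
    (twistorForm nabla e x₀).ad.covDeriv (𝓘(ℝ, EM).prod (𝓡 2)) (tautJ k) z ξ =
      quatAction (QSpace k) (dS z ξ) := by
  rw [covDeriv_tautJ hz₀, hξ, ConnectionForm.oneForm, map_zero, map_zero, zero_lie, add_zero]

lemma isHorizontal_iff_covDeriv_tautJ_eq_zero (hz : z.1 ∈ e.baseSet)
    (hz₀ : z.1 ∈ (chartAt EM x₀).source) (ξ : TZ (EM := EM) z) :
    IsHorizontal nabla e z ξ ↔
      (twistorForm nabla e x₀).ad.covDeriv (𝓘(ℝ, EM).prod (𝓡 2)) (tautJ k) z ξ = 0 := by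
  have hconn (q : QSpace k) : connForm nabla e z.1 (dπ z ξ) q =
      (connectionForm nabla e x₀).oneForm 𝓘(ℝ, EM) z.1 (dπ z ξ) q :=
    (oneForm_connectionForm hz hz₀ _ _).symm
  rw [covDeriv_tautJ hz₀, ContinuousLinearMap.ext_iff]
  refine forall_congr' fun q => ?_
  rw [hconn, hconn, add_sub_assoc]
  rfl

lemma exists_vertical_covDeriv_tautJ_eq [Nontrivial (QSpace k)] (hcompat : IsCompatible nabla)
    (hz : z.1 ∈ e.baseSet) (hz₀ : z.1 ∈ (chartAt EM x₀).source) (ξ : TZ (EM := EM) z) :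
    ∃ v : TZ (EM := EM) z, dπ z v = 0 ∧
      (twistorForm nabla e x₀).ad.covDeriv (𝓘(ℝ, EM).prod (𝓡 2)) (tautJ k) z v =
        (twistorForm nabla e x₀).ad.covDeriv (𝓘(ℝ, EM).prod (𝓡 2)) (tautJ k) z ξ := by
  obtain ⟨n, hn, hlie⟩ := exists_anticommute_eq_lie
    (hcompat.form_mem_quaternionicEnd hz hz₀ (mvfderiv 𝓘(ℝ, EM) _ z.1 (dπ z ξ)))
    (imQ_mul_self z.2)
  obtain ⟨v, hv, hSv⟩ := exists_vertical (EM := EM) z (n := dS z ξ + n)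
    (by rw [add_mul, mul_add, dS_mul_imQ, hn, neg_add])
  refine ⟨v, hv, ?_⟩
  rw [covDeriv_tautJ_of_dπ_eq_zero hz₀ hv, hSv, covDeriv_tautJ hz₀, map_add, hlie]
  rfl

lemma mem_vert01_iff [Nontrivial (QSpace k)] (hz₀ : z.1 ∈ (chartAt EM x₀).source)
    {v : TZ (EM := EM) z × TZ (EM := EM) z} :
    v ∈ vert01 z ↔ dπ z v.1 = 0 ∧ dπ z v.2 = 0 ∧
      (twistorForm nabla e x₀).ad.covDeriv (𝓘(ℝ, EM).prod (𝓡 2)) (tautJ k) z v.2 =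
        tautJ k z *
          (twistorForm nabla e x₀).ad.covDeriv (𝓘(ℝ, EM).prod (𝓡 2)) (tautJ k) z v.1 := by
  have hsq (q : ℍ[ℝ]) : LinearMap.mulLeft ℝ (imQ z.2) (LinearMap.mulLeft ℝ (imQ z.2) q) = -q := by
    rw [LinearMap.mulLeft_apply, LinearMap.mulLeft_apply, ← mul_assoc, imQ_mul_self, neg_one_mul]
  refine and_congr_right fun h₁ => and_congr_right fun h₂ => ?_
  rw [mem_kerAddI_iff hsq, covDeriv_tautJ_of_dπ_eq_zero hz₀ h₁,
    covDeriv_tautJ_of_dπ_eq_zero hz₀ h₂, tautJ, ← map_mul]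
  exact (quatAction (QSpace k)).toRingHom.injective.eq_iff.symm

lemma mem_horB_iff (hz : z.1 ∈ e.baseSet) (hz₀ : z.1 ∈ (chartAt EM x₀).source)
    {ζ : TZ (EM := EM) z × TZ (EM := EM) z} :
    ζ ∈ horB nabla ρ e z ↔
      (twistorForm nabla e x₀).ad.covDeriv (𝓘(ℝ, EM).prod (𝓡 2)) (tautJ k) z ζ.1 = 0 ∧
      (twistorForm nabla e x₀).ad.covDeriv (𝓘(ℝ, EM).prod (𝓡 2)) (tautJ k) z ζ.2 = 0 ∧
      ∃ u : QSpace k, dπ z ζ.1 = ρ z.1 (e.symmₗ ℝ z.1 u) ∧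
        dπ z ζ.2 = ρ z.1 (e.symmₗ ℝ z.1 (imQ z.2 • u)) := by
  refine and_congr (isHorizontal_iff_covDeriv_tautJ_eq_zero hz hz₀ _)
    (and_congr (isHorizontal_iff_covDeriv_tautJ_eq_zero hz hz₀ _) ⟨?_, ?_⟩)
  · rintro ⟨w, hw, h₁, h₂⟩
    obtain ⟨u, hu₁, hu₂⟩ := (mem_kerAddI_trivJ_iff hz z.2 w).1 hw
    exact ⟨u, hu₁ ▸ h₁, hu₂ ▸ h₂⟩
  · rintro ⟨u, h₁, h₂⟩
    exact ⟨_, (mem_kerAddI_trivJ_iff hz z.2 (_, _)).2 ⟨u, rfl, rfl⟩, h₁, h₂⟩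

lemma mem_twistorDist_iff (hz₀ : z.1 ∈ (chartAt EM x₀).source)
    {ζ : TZ (EM := EM) z × TZ (EM := EM) z} :
    ζ ∈ twistorDist (𝓘(ℝ, EM).prod (𝓡 2)) (twistorForm nabla e x₀)
        (anchorForm ρ e x₀ ∘ Prod.fst) (tautJ k) z ↔
      (twistorForm nabla e x₀).ad.covDeriv (𝓘(ℝ, EM).prod (𝓡 2)) (tautJ k) z ζ.2 =
        tautJ k z *
          (twistorForm nabla e x₀).ad.covDeriv (𝓘(ℝ, EM).prod (𝓡 2)) (tautJ k) z ζ.1 ∧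
      ∃ u : QSpace k, dπ z ζ.1 = ρ z.1 (e.symmₗ ℝ z.1 u) ∧
        dπ z ζ.2 = ρ z.1 (e.symmₗ ℝ z.1 (imQ z.2 • u)) :=
  and_congr_right fun _ => exists_congr fun u =>
    and_congr (mvfderiv_base_twistorForm_eq_anchorForm_iff hz₀ _ u)
      (mvfderiv_base_twistorForm_eq_anchorForm_iff hz₀ _ (imQ z.2 • u))

lemma mem_distC_iff [Nontrivial (QSpace k)] (hcompat : IsCompatible nabla) (hz : z.1 ∈ e.baseSet)
    (hz₀ : z.1 ∈ (chartAt EM x₀).source) {ζ : TZ (EM := EM) z × TZ (EM := EM) z} :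
    ζ ∈ distC nabla ρ e z ↔
      ζ ∈ twistorDist (𝓘(ℝ, EM).prod (𝓡 2)) (twistorForm nabla e x₀)
        (anchorForm ρ e x₀ ∘ Prod.fst) (tautJ k) z := by
  have hdπ_add (ξ η : TZ (EM := EM) z) : dπ z (ξ + η) = dπ z ξ + dπ z η := map_add _ ξ η
  have hdπ_sub (ξ η : TZ (EM := EM) z) : dπ z (ξ - η) = dπ z ξ - dπ z η := map_sub _ ξ η
  rw [mem_twistorDist_iff hz₀]
  constructor
  · rintro ⟨v, hv, b, hb, rfl⟩
    obtain ⟨hv₁, hv₂, hv⟩ := (mem_vert01_iff (nabla := nabla) (e := e) hz₀).1 hv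
    obtain ⟨hb₁, hb₂, u, hu₁, hu₂⟩ := (mem_horB_iff hz hz₀).1 hb
    refine ⟨?_, u, ?_, ?_⟩
    · simp only [Prod.fst_add, Prod.snd_add, ConnectionForm.covDeriv_add, hb₁, hb₂, add_zero, hv]
    · rw [Prod.fst_add, hdπ_add, hv₁, zero_add, hu₁]
    · rw [Prod.snd_add, hdπ_add, hv₂, zero_add, hu₂]
  · rintro ⟨hζ, u, hu₁, hu₂⟩
    obtain ⟨v₁, hv₁, hζ₁⟩ := exists_vertical_covDeriv_tautJ_eq hcompat hz hz₀ ζ.1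
    obtain ⟨v₂, hv₂, hζ₂⟩ := exists_vertical_covDeriv_tautJ_eq hcompat hz hz₀ ζ.2
    refine ⟨(v₁, v₂), (mem_vert01_iff (nabla := nabla) (e := e) hz₀).2
      ⟨hv₁, hv₂, by rw [hζ₁, hζ₂, hζ]⟩, ζ - (v₁, v₂), (mem_horB_iff hz hz₀).2 ⟨?_, ?_, u, ?_, ?_⟩,
      (add_sub_cancel _ _).symm⟩
    · rw [Prod.fst_sub, ConnectionForm.covDeriv_sub, hζ₁, sub_self]
    · rw [Prod.snd_sub, ConnectionForm.covDeriv_sub, hζ₂, sub_self]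
    · rw [Prod.fst_sub, hdπ_sub, hv₁, sub_zero, hu₁]
    · rw [Prod.snd_sub, hdπ_sub, hv₂, sub_zero, hu₂]

end TwistorSpace

section Integrability

variable {EM : Type*} [NormedAddCommGroup EM] [NormedSpace ℝ EM] [FiniteDimensional ℝ EM]
  {M : Type*} [TopologicalSpace M] [T2Space M] [ChartedSpace EM M] [IsManifold 𝓘(ℝ, EM) ∞ M]
  {k : ℕ} {V : M → Type*} [TopologicalSpace (TotalSpace (QSpace k) V)]
  [∀ x, AddCommGroup (V x)] [∀ x, Module ℝ (V x)] [∀ x, TopologicalSpace (V x)]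
  [∀ x, IsTopologicalAddGroup (V x)] [∀ x, ContinuousSMul ℝ (V x)]
  [FiberBundle (QSpace k) V] [VectorBundle ℝ (QSpace k) V]
  [ContMDiffVectorBundle ∞ (QSpace k) V 𝓘(ℝ, EM)]
  {ρ : ∀ x : M, V x →ₗ[ℝ] TangentSpace 𝓘(ℝ, EM) x}
  {nabla : CovariantDerivative 𝓘(ℝ, EM) (QSpace k) V} [nabla.ContMDiffCovariantDerivative ∞]
  {e : Trivialization (QSpace k) (π (QSpace k) V)} [MemTrivializationAtlas e]
  {x : M} {z : M × S2}

/-- The operation `(u, v) ↦ R(ρ u, ρ v)` at `x`, in a trivialization. -/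
def anchoredCurv (nabla : CovariantDerivative 𝓘(ℝ, EM) (QSpace k) V)
    (ρ : ∀ x : M, V x →ₗ[ℝ] TangentSpace 𝓘(ℝ, EM) x)
    (e : Trivialization (QSpace k) (π (QSpace k) V)) [MemTrivializationAtlas e] (x : M)
    (u v : QSpace k) : QSpace k →L[ℝ] QSpace k :=
  (connectionForm nabla e x).curv 𝓘(ℝ, EM) x (ρ x (e.symmₗ ℝ x u)) (ρ x (e.symmₗ ℝ x v))

lemma linearMapAt_curvatureRhoC (hx : x ∈ e.baseSet) (u v w : QSpace k × QSpace k) :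
    Prod.map (e.linearMapAt ℝ x) (e.linearMapAt ℝ x) (curvatureRhoC nabla ρ x
        (Prod.map (e.symmₗ ℝ x) (e.symmₗ ℝ x) u) (Prod.map (e.symmₗ ℝ x) (e.symmₗ ℝ x) v)
        (Prod.map (e.symmₗ ℝ x) (e.symmₗ ℝ x) w)) =
      complexify₂ (fun (f : QSpace k →L[ℝ] QSpace k) (q : QSpace k) => f q)
        (complexify₂ (anchoredCurv nabla ρ e x) u v) w := by
  simp only [curvatureRhoC, complexify₂, Prod.map, Pi.add_apply, Pi.sub_apply, map_add, map_sub,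
    linearMapAt_curvature hx, e.linearMapAt_symmₗ hx, anchoredCurv, add_apply, sub_apply]

lemma SatisfiesFirstBianchi.cyclic_sum_anchoredCurv (h : SatisfiesFirstBianchi nabla ρ)
    (hx : x ∈ e.baseSet) (a : S2) (u v w : QSpace k) :
    complexify₂ (fun (f : QSpace k →L[ℝ] QSpace k) (q : QSpace k) => f q)
        (complexify₂ (anchoredCurv nabla ρ e x) (u, imQ a • u) (v, imQ a • v)) (w, imQ a • w)
      + complexify₂ (fun (f : QSpace k →L[ℝ] QSpace k) (q : QSpace k) => f q)
        (complexify₂ (anchoredCurv nabla ρ e x) (v, imQ a • v) (w, imQ a • w)) (u, imQ a • u)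
      + complexify₂ (fun (f : QSpace k →L[ℝ] QSpace k) (q : QSpace k) => f q)
        (complexify₂ (anchoredCurv nabla ρ e x) (w, imQ a • w) (u, imQ a • u)) (v, imQ a • v)
      = 0 := by
  have hmem (q : QSpace k) : Prod.map (e.symmₗ ℝ x) (e.symmₗ ℝ x) (q, imQ a • q) ∈
      kerAddI (trivJ e x a) :=
    (mem_kerAddI_trivJ_iff hx a _).2 ⟨q, rfl, rfl⟩
  have hsum := h.bianchi x (trivJ e x a) ⟨e, inferInstance, hx, a, rfl⟩
    _ (hmem u) _ (hmem v) _ (hmem w)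
  rw [← linearMapAt_curvatureRhoC hx, ← linearMapAt_curvatureRhoC hx,
    ← linearMapAt_curvatureRhoC hx]
  have hsum' := congrArg ((e.linearMapAt ℝ x).prodMap (e.linearMapAt ℝ x)) hsum
  rw [map_add, map_add, map_zero] at hsum'
  exact hsum'

lemma tautJ_mul_lie_complexify₂_curv (hrank : 4 < Module.finrank ℝ (QSpace k))
    (hcompat : IsCompatible nabla) (hbianchi : SatisfiesFirstBianchi nabla ρ)
    (hz : z.1 ∈ e.baseSet) {ξ η : TZ (EM := EM) z × TZ (EM := EM) z}
    (hξ : ξ ∈ twistorDist (𝓘(ℝ, EM).prod (𝓡 2)) (twistorForm nabla e z.1)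
      (anchorForm ρ e z.1 ∘ Prod.fst) (tautJ k) z)
    (hη : η ∈ twistorDist (𝓘(ℝ, EM).prod (𝓡 2)) (twistorForm nabla e z.1)
      (anchorForm ρ e z.1 ∘ Prod.fst) (tautJ k) z) :
    tautJ k z * ⁅(complexify₂ ((twistorForm nabla e z.1).curv (𝓘(ℝ, EM).prod (𝓡 2)) z) ξ η).1,
        tautJ k z⁆ =
      ⁅(complexify₂ ((twistorForm nabla e z.1).curv (𝓘(ℝ, EM).prod (𝓡 2)) z) ξ η).2,
        tautJ k z⁆ := by
  obtain ⟨-, u, hu₁, hu₂⟩ := (mem_twistorDist_iff (mem_chart_source EM z.1)).1 hξ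
  obtain ⟨-, v, hv₁, hv₂⟩ := (mem_twistorDist_iff (mem_chart_source EM z.1)).1 hη
  have hcurv : complexify₂ ((twistorForm nabla e z.1).curv (𝓘(ℝ, EM).prod (𝓡 2)) z) ξ η =
      complexify₂ (anchoredCurv nabla ρ e z.1) (u, imQ z.2 • u) (v, imQ z.2 • v) := by
    have hpull (ξ η : TZ (EM := EM) z) :
        (twistorForm nabla e z.1).curv (𝓘(ℝ, EM).prod (𝓡 2)) z ξ η =
          (connectionForm nabla e z.1).curv 𝓘(ℝ, EM) z.1 (dπ z ξ) (dπ z η) :=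
      ConnectionForm.curv_pullback (isRegularAt_connectionForm hz) mdifferentiableAt_fst ξ η
    simp only [complexify₂, hpull, hu₁, hu₂, hv₁, hv₂, anchoredCurv]
  rw [hcurv]
  exact lie_complexify₂_eq_of_bianchi hrank
    (fun _ _ => hcompat.curv_mem_quaternionicEnd hz _ _) (imQ_mul_self z.2)
    (hbianchi.cyclic_sum_anchoredCurv hz z.2) u v

lemma isTorsionFreeCoCRAt_twistorForm
    (hρ : ContMDiff (𝓘(ℝ, EM).prod 𝓘(ℝ, QSpace k)) (𝓘(ℝ, EM).prod 𝓘(ℝ, EM)) ∞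
      fun v : TotalSpace (QSpace k) V => (⟨v.1, ρ v.1 v.2⟩ : TangentBundle 𝓘(ℝ, EM) M))
    (hker : ∀ x, ∀ J ∈ admissible k V x, ∀ W : Submodule ℝ (V x),
      W ≤ LinearMap.ker (ρ x) → (∀ w ∈ W, J w ∈ W) → W = ⊥)
    (htorsion : IsTorsionFree nabla ρ) (hz : z.1 ∈ e.baseSet) :
    IsTorsionFreeCoCRAt (𝓘(ℝ, EM).prod (𝓡 2)) (twistorForm nabla e z.1)
      (anchorForm ρ e z.1 ∘ Prod.fst) (tautJ k) z where
  regular := (isRegularAt_connectionForm hz).pullback contMDiffAt_fst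
  anchor := (mdifferentiableAt_anchorForm hρ hz).comp z mdifferentiableAt_fst
  smooth := contMDiffAt_tautJ EM z
  sq := .of_forall tautJ_mul_self
  torsionFree := (htorsion.isTorsionFreeAt hρ hz).pullback_fst
    (mdifferentiableAt_base_connectionForm (mem_chart_source EM z.1))
    (mdifferentiableAt_anchorForm hρ hz)
  injective q h₁ h₂ := by
    have hzero {q : QSpace k} (h : anchorForm ρ e z.1 z.1 q = 0) :
        ρ z.1 (e.symmₗ ℝ z.1 q) = 0 :=
      ((mvfderiv_extChartAt_eq_anchorForm_iff (mem_chart_source EM z.1) 0 q).1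
        ((map_zero _).trans h.symm)).symm
    exact eq_zero_of_mem_ker_anchor hz z.2 (hker z.1) (hzero h₁) (hzero h₂)

omit [T2Space M] [nabla.ContMDiffCovariantDerivative ∞] in
lemma IsSectionOfC.isSectionAt [Nontrivial (QSpace k)] (hcompat : IsCompatible nabla)
    {O : Set (M × S2)} (hO : IsOpen O) (hOe : O ⊆ e.baseSet ×ˢ univ)
    {X : (∀ z : M × S2, TZ (EM := EM) z) × (∀ z : M × S2, TZ (EM := EM) z)}
    (hX : IsSectionOfC nabla ρ e O X) (hz : z ∈ O) :
    IsSectionAt (𝓘(ℝ, EM).prod (𝓡 2)) (twistorDist (𝓘(ℝ, EM).prod (𝓡 2))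
      (twistorForm nabla e z.1) (anchorForm ρ e z.1 ∘ Prod.fst) (tautJ k)) X z where
  fst := (hX.1.contMDiffAt (hO.mem_nhds hz)).mdifferentiableAt (by simp)
  snd := (hX.2.1.contMDiffAt (hO.mem_nhds hz)).mdifferentiableAt (by simp)
  mem := by
    filter_upwards [hO.mem_nhds hz,
      continuous_fst.continuousAt (chart_source_mem_nhds EM z.1)] with y hyO hy₀
    exact (mem_distC_iff hcompat (hOe hyO).1 hy₀).1 (hX.2.2 y hyO)

end Integrability

end CoCR

theorem corollary2p3_general
    {EM : Type*} [NormedAddCommGroup EM] [NormedSpace ℝ EM] [FiniteDimensional ℝ EM]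
    {M : Type*} [TopologicalSpace M] [T2Space M] [ChartedSpace EM M] [IsManifold 𝓘(ℝ, EM) ∞ M]
    {k : ℕ} {V : M → Type*} [TopologicalSpace (TotalSpace (CoCR.QSpace k) V)]
    [∀ x, AddCommGroup (V x)] [∀ x, Module ℝ (V x)] [∀ x, TopologicalSpace (V x)]
    [∀ x, IsTopologicalAddGroup (V x)] [∀ x, ContinuousSMul ℝ (V x)]
    [FiberBundle (CoCR.QSpace k) V] [VectorBundle ℝ (CoCR.QSpace k) V]
    [ContMDiffVectorBundle ∞ (CoCR.QSpace k) V 𝓘(ℝ, EM)]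
    (ρ : ∀ x : M, V x →ₗ[ℝ] TangentSpace 𝓘(ℝ, EM) x)
    (hsmooth : ContMDiff (𝓘(ℝ, EM).prod 𝓘(ℝ, CoCR.QSpace k)) (𝓘(ℝ, EM).prod 𝓘(ℝ, EM)) ∞
      fun v : TotalSpace (CoCR.QSpace k) V => (⟨v.1, ρ v.1 v.2⟩ : TangentBundle 𝓘(ℝ, EM) M))
    (hker : ∀ x, ∀ J ∈ CoCR.admissible k V x, ∀ W : Submodule ℝ (V x),
      W ≤ LinearMap.ker (ρ x) → (∀ w ∈ W, J w ∈ W) → W = ⊥)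
    (hrank : 4 < Module.finrank ℝ (CoCR.QSpace k))
    (nabla : CovariantDerivative 𝓘(ℝ, EM) (CoCR.QSpace k) V)
    [nabla.ContMDiffCovariantDerivative ∞]
    (hcompat : CoCR.IsCompatible nabla)
    (hbianchi : CoCR.SatisfiesFirstBianchi nabla ρ) :
    CoCR.IsIntegrable nabla ρ := by
  intro e _ O hO hOe X Y hX hY z hz
  have hze : z.1 ∈ e.baseSet := (hOe hz).1
  have : Nontrivial (CoCR.QSpace k) := Module.nontrivial_of_finrank_pos (R := ℝ) (by omega)
  have hlocal := CoCR.isTorsionFreeCoCRAt_twistorForm hsmooth hker hbianchi.torsionFree hze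
  exact (CoCR.mem_distC_iff hcompat hze (mem_chart_source EM z.1)).2 <|
    hlocal.complexify₂_mlieBracket_mem
      (fun ξ hξ η hη => CoCR.tautJ_mul_lie_complexify₂_curv hrank hcompat hbianchi hze hξ hη)
      (hX.isSectionAt hcompat hO hOe hz) (hY.isSectionAt hcompat hO hOe hz)

end

theorem corollary2p3
    {EM : Type*} [NormedAddCommGroup EM] [NormedSpace ℝ EM] [FiniteDimensional ℝ EM]
    {M : Type*} [TopologicalSpace M] [T2Space M] [ChartedSpace EM M] [IsManifold 𝓘(ℝ, EM) ∞ M]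
    {k : ℕ} {V : M → Type*} [TopologicalSpace (TotalSpace (CoCR.QSpace k) V)]
    [∀ x, AddCommGroup (V x)] [∀ x, Module ℝ (V x)] [∀ x, TopologicalSpace (V x)]
    [∀ x, IsTopologicalAddGroup (V x)] [∀ x, ContinuousSMul ℝ (V x)]
    [FiberBundle (CoCR.QSpace k) V] [VectorBundle ℝ (CoCR.QSpace k) V]
    [ContMDiffVectorBundle ∞ (CoCR.QSpace k) V 𝓘(ℝ, EM)]
    (ρ : ∀ x : M, V x →ₗ[ℝ] TangentSpace 𝓘(ℝ, EM) x)
    (hρ : CoCR.IsAlmostCoCRQuaternionic k ρ)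
    (hrank : 4 < Module.finrank ℝ (CoCR.QSpace k))
    (nabla : CovariantDerivative 𝓘(ℝ, EM) (CoCR.QSpace k) V)
    [nabla.ContMDiffCovariantDerivative ∞]
    (hcompat : CoCR.IsCompatible nabla)
    (hbianchi : CoCR.SatisfiesFirstBianchi nabla ρ) :
    CoCR.IsIntegrable nabla ρ :=
  corollary2p3_general ρ hρ.smooth hρ.kernel hrank nabla hcompat hbianchi
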